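/- **Setting.** An episodic infinite-horizon adversarial MDP consists of a finite state space $\mathcal S$ with $|\mathcal S|=S$, a finite action space $\mathcal A$ with $|\mathcal A|=A$, a transition kernel $P(s'\mid s,a)$, loss functions $\ell_k:\mathcal S\times\mathcal A\to[0,1]$ for the episodes $k=1,\dots,K$ (chosen in advance), a discount factor $\gamma\in[0,1)$ and an initial distribution $d_0$ on $\mathcal S$. It has a *fixed loss function* if $\ell_1=\dots=\ell_K$. It is a *low-rank MDP* (of dimension $d$) if there are $\phi:\mathcal S\times\mathcal A\to\mathbb R^d$ and $\mu:\mathcal S\to\mathbb R^d$ with $P(s'\mid s,a)=\mu(s')^\top\phi(s,a)$ for all $s,a,s'$, $\|\phi(s,a)\|_2\le 1$ for all $s,a$, and $\big\|\sum_{s}\mu(s)g(s)\big\|_2\le\sqrt d$ for every $g:\mathcal S\to[0,1]$. For a stochastic policy $\pi(a\mid s)$ put $V_k^\pi=\mathbb E\big[\sum_{\tau\ge 0}\gamma^\tau\ell_k(s_\tau,a_\tau)\big]$, where $s_0\sim d_0$, $a_\tau\sim\pi(\cdot\mid s_\tau)$, $s_{\tau+1}\sim P(\cdot\mid s_\tau,a_\tau)$.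 A (possibly randomized) algorithm chooses at the start of each episode $k$ a stochastic policy $\pi_k$ on the basis of what it has seen in the earlier episodes: its own policies, the trajectories generated by executing them (even if it is shown the whole infinite trajectories), and the loss functions of those episodes. It is also told $d_0$ and a finite model class $\{(\mu,\phi):\mu\in\Psi,\phi\in\Phi\}$ that contains a pair $(\mu,\phi)$ with $P(s'\mid s,a)=\mu(s')^\top\phi(s,a)$, and whose members all satisfy the two norm bounds above and $\sum_{s'}\mu(s')^\top\phi(s,a)=1$; it may depend on $d,S,A,K,\gamma$. Its expected regret is $\mathcal R_K=\mathbb E\big[\sum_{k=1}^K(V_k^{\pi_k}-V_k^{\pi^\star})\big]$, where $\pi^\star$ minimizes $\sum_{k=1}^K V_k^{\pi}$ over all stochastic policies $\pi$. **Theorem.** There is an absolute constant $c>0$ such that the following holds. Let $d,S,A,K$ be natural numbers with $d\ge 8$, $S\ge d+1$, $A\ge d-3$ and $K\ge 2(d-4)A$, and let $\gamma\in[0,1)$. Then for every algorithm there exist an episodic infinite-horizon low-rank MDP of dimension $d$ with $S$ states, $A$ actions, $K$ episodes, discount factor $\gamma$ and a fixed loss function, and a finite model class as above for it, such that the expected regret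 of the algorithm on this MDP satisfies $$\mathcal R_K\;\ge\; c\,\frac{\gamma^2}{1-\gamma}\sqrt{dAK}.$$ -/

import Mathlib

open MeasureTheory ProbabilityTheory

/-- An episodic infinite-horizon adversarial MDP with `S` states, `A` actions and `K` episodes:
transition kernel `P`, loss functions `loss k` with values in `[0,1]` (all chosen in advance, one for
each episode), discount factor `γ ∈ [0,1)`, and initial distribution `d₀`. -/
structure AdversarialMDP (S A K : ℕ) where
  P : Fin S → Fin A → stdSimplex ℝ (Fin S)
  loss : Fin K → Fin S → Fin A → ℝ
  loss_mem : ∀ k s a, loss k s a ∈ Set.Icc (0 : ℝ) 1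
  γ : ℝ
  γ_nonneg : 0 ≤ γ
  γ_lt_one : γ < 1
  d₀ : stdSimplex ℝ (Fin S)

/-- A feature map of state-action pairs, `φ : 𝒮 × 𝒜 → ℝᵈ`. -/
abbrev StateActionFeature (d S A : ℕ) : Type := Fin S → Fin A → EuclideanSpace ℝ (Fin d)

/-- A feature map of states, `μ : 𝒮 → ℝᵈ`. -/
abbrev StateFeature (d S : ℕ) : Type := Fin S → EuclideanSpace ℝ (Fin d)

/-- The transition kernel is the bilinear form `P(s' | s, a) = μ(s')ᵀ φ(s, a)`. -/
def AdversarialMDP.FactorsThrough {d S A K : ℕ} (M : AdversarialMDP S A K)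
    (φ : StateActionFeature d S A) (μ : StateFeature d S) : Prop :=
  ∀ s a s', M.P s a s' = inner ℝ (μ s') (φ s a)

/-- `‖φ(s,a)‖₂ ≤ 1` for all state-action pairs. -/
def StateActionFeature.Normalized {d S A : ℕ} (φ : StateActionFeature d S A) : Prop :=
  ∀ s a, ‖φ s a‖ ≤ 1

/-- `‖∫ μ(s) g(s) ds‖₂ ≤ √d` for every `g : 𝒮 → [0,1]`. -/
def StateFeature.Normalized {d S : ℕ} (μ : StateFeature d S) : Prop :=
  ∀ g : Fin S → ℝ, (∀ s, g s ∈ Set.Icc (0 : ℝ) 1) → ‖∑ s, g s • μ s‖ ≤ √(d : ℝ)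

/-- Low-rank MDPs (of dimension `d`). -/
def AdversarialMDP.IsLowRank {S A K : ℕ} (d : ℕ) (M : AdversarialMDP S A K) : Prop :=
  ∃ (φ : StateActionFeature d S A) (μ : StateFeature d S),
    M.FactorsThrough φ μ ∧ φ.Normalized ∧ μ.Normalized

/-- The loss function is the same in all episodes. -/
def AdversarialMDP.HasFixedLoss {S A K : ℕ} (M : AdversarialMDP S A K) : Prop :=
  ∃ l : Fin S → Fin A → ℝ, ∀ k, M.loss k = l

/-- A finite model class `{(μ, φ) : μ ∈ Ψ, φ ∈ Φ}`, which is known to the learner. -/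
structure ModelClass (d S A : ℕ) where
  Ψ : Finset (StateFeature d S)
  Φ : Finset (StateActionFeature d S A)
  φ_normalized : ∀ φ ∈ Φ, φ.Normalized
  μ_normalized : ∀ μ ∈ Ψ, μ.Normalized
  sum_eq_one : ∀ μ ∈ Ψ, ∀ φ ∈ Φ, ∀ s a, ∑ s', inner ℝ (μ s') (φ s a) = 1

/-- Realizability: the model class contains the true features of `M`. -/
def ModelClass.Realizes {d S A K : ℕ} (C : ModelClass d S A) (M : AdversarialMDP S A K) : Prop :=
  ∃ μ ∈ C.Ψ, ∃ φ ∈ C.Φ, M.FactorsThrough φ μ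

/-- Stochastic (stationary) policies: `π s` is the distribution of the action taken in state `s`. -/
abbrev Policy (S A : ℕ) : Type := Fin S → stdSimplex ℝ (Fin A)

/-- Infinite trajectories `(s₀, a₀), (s₁, a₁), …`. -/
abbrev Trajectory (S A : ℕ) : Type := ℕ → Fin S × Fin A

/-! ### Trajectories and values -/

/-- The law of `(s, a)` with `s ∼ ρ` and `a ∼ π(· | s)`. -/
noncomputable def stateActionLaw {S A : ℕ} (ρ : stdSimplex ℝ (Fin S)) (π : Policy S A) :
    Measure (Fin S × Fin A) :=
  ∑ x : Fin S × Fin A, ENNReal.ofReal (ρ x.1 * π x.1 x.2) • Measure.dirac x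

instance {S A : ℕ} (ρ : stdSimplex ℝ (Fin S)) (π : Policy S A) :
    IsProbabilityMeasure (stateActionLaw ρ π) := by
  constructor
  simp only [stateActionLaw, Measure.coe_finsetSum, Finset.sum_apply, Measure.smul_apply,
    measure_univ, smul_eq_mul, mul_one]
  rw [← ENNReal.ofReal_sum_of_nonneg (fun x _ => mul_nonneg (by simp) (by simp)),
    Fintype.sum_prod_type]
  simp [← Finset.mul_sum]

/-- One step of the chain of state-action pairs under transitions `P` and policy `π`:
from `(s, a)` move to `(s', a')` with `s' ∼ P(· | s, a)` and `a' ∼ π(· | s')`. -/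
noncomputable def stepKernel {S A : ℕ} (P : Fin S → Fin A → stdSimplex ℝ (Fin S))
    (π : Policy S A) : Kernel (Fin S × Fin A) (Fin S × Fin A) :=
  Kernel.ofFunOfCountable fun x => stateActionLaw (P x.1 x.2) π

instance {S A : ℕ} (P : Fin S → Fin A → stdSimplex ℝ (Fin S)) (π : Policy S A) :
    IsMarkovKernel (stepKernel P π) :=
  ⟨fun x => inferInstanceAs (IsProbabilityMeasure (stateActionLaw (P x.1 x.2) π))⟩

/-- The next state-action pair given the past of the trajectory (it depends on the last pair). -/
noncomputable def nextKernel {S A : ℕ} (P : Fin S → Fin A → stdSimplex ℝ (Fin S))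
    (π : Policy S A) (n : ℕ) :
    Kernel ((i : Finset.Iic n) → (fun _ : ℕ => Fin S × Fin A) i) (Fin S × Fin A) :=
  (stepKernel P π).comap (fun h => h ⟨n, Finset.mem_Iic.2 le_rfl⟩) (measurable_pi_apply _)

instance {S A : ℕ} (P : Fin S → Fin A → stdSimplex ℝ (Fin S)) (π : Policy S A) (n : ℕ) :
    IsMarkovKernel (nextKernel P π n) := by
  unfold nextKernel; infer_instance

/-- The law of the infinite trajectory with `s₀ ∼ ρ`, `aₕ ∼ π(· | sₕ)`, `sₕ₊₁ ∼ P(· | sₕ, aₕ)`. -/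
noncomputable def trajectoryLaw {S A : ℕ} (P : Fin S → Fin A → stdSimplex ℝ (Fin S))
    (ρ : stdSimplex ℝ (Fin S)) (π : Policy S A) : Measure (Trajectory S A) :=
  Kernel.trajMeasure (X := fun _ => Fin S × Fin A) (stateActionLaw ρ π) (nextKernel P π)

instance {S A : ℕ} (P : Fin S → Fin A → stdSimplex ℝ (Fin S)) (ρ : stdSimplex ℝ (Fin S))
    (π : Policy S A) : IsProbabilityMeasure (trajectoryLaw P ρ π) := by
  unfold trajectoryLaw; infer_instance

/-- State value `V_k^π(s) = 𝔼[∑_τ γ^τ ℓ_k(s_τ, a_τ) | π, P, s₀ = s]`. -/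
noncomputable def AdversarialMDP.stateValue {S A K : ℕ} (M : AdversarialMDP S A K) (k : Fin K)
    (π : Policy S A) (s : Fin S) : ℝ :=
  ∫ ω, ∑' τ : ℕ, M.γ ^ τ * M.loss k (ω τ).1 (ω τ).2
    ∂(trajectoryLaw M.P (stdSimplex.vertex s) π)

/-- `V_k^π = 𝔼_{s₀ ∼ d₀}[V_k^π(s₀)]`. -/
noncomputable def AdversarialMDP.value {S A K : ℕ} (M : AdversarialMDP S A K) (k : Fin K)
    (π : Policy S A) : ℝ :=
  ∑ s, M.d₀ s * M.stateValue k π s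

/-- `π` is optimal in hindsight: it minimizes `∑_k V_k^π` over all stochastic policies. -/
def AdversarialMDP.IsOptimalInHindsight {S A K : ℕ} (M : AdversarialMDP S A K)
    (π : Policy S A) : Prop :=
  ∀ π' : Policy S A, ∑ k, M.value k π ≤ ∑ k, M.value k π'

/-! ### The trajectory law as a kernel in the policy -/

theorem measurable_policy_apply {S A : ℕ} (s : Fin S) (a : Fin A) :
    Measurable (fun π : Policy S A => π s a) :=
  (measurable_pi_apply a).comp (measurable_subtype_coe.comp (measurable_pi_apply s))

theorem measurable_stateActionLaw {S A : ℕ} (ρ : stdSimplex ℝ (Fin S)) :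
    Measurable (fun π : Policy S A => stateActionLaw ρ π) := by
  refine Measure.measurable_of_measurable_coe _ fun s _ => ?_
  simp only [stateActionLaw, Measure.coe_finsetSum, Finset.sum_apply, Measure.smul_apply,
    smul_eq_mul]
  refine Finset.measurable_sum _ fun x _ => Measurable.mul_const ?_ _
  exact ENNReal.measurable_ofReal.comp ((measurable_policy_apply x.1 x.2).const_mul _)

theorem measurable_trajectoryLaw {S A : ℕ} (P : Fin S → Fin A → stdSimplex ℝ (Fin S))
    (ρ : stdSimplex ℝ (Fin S)) :
    Measurable (fun π : Policy S A => trajectoryLaw P ρ π) := by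
  -- first, the law of the first `n + 1` pairs depends measurably on the policy
  have hfin : ∀ n : ℕ, Measurable fun π : Policy S A =>
      (trajectoryLaw P ρ π).map (Preorder.frestrictLe (π := fun _ : ℕ => Fin S × Fin A) n) := by
    intro n
    induction n with
    | zero =>
      have h0 : ∀ π : Policy S A, (trajectoryLaw P ρ π).map
          (Preorder.frestrictLe (π := fun _ : ℕ => Fin S × Fin A) 0) =
          (stateActionLaw ρ π).map (MeasurableEquiv.piUnique
            (fun i : Finset.Iic (0 : ℕ) => (fun _ : ℕ => Fin S × Fin A) i)).symm := by
        intro π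
        rw [trajectoryLaw, Kernel.trajMeasure, Measure.map_comp _ _ (by fun_prop),
          Kernel.traj_map_frestrictLe, Kernel.partialTraj_self, Measure.id_comp]
      simp_rw [h0]
      exact (Measure.measurable_map _ (MeasurableEquiv.measurable _)).comp
        (measurable_stateActionLaw ρ)
    | succ n ih =>
      have h1 : ∀ π : Policy S A, (trajectoryLaw P ρ π).map
          (Preorder.frestrictLe (π := fun _ : ℕ => Fin S × Fin A) (n + 1)) =
          ((trajectoryLaw P ρ π).map
            (Preorder.frestrictLe (π := fun _ : ℕ => Fin S × Fin A) n) ⊗ₘ nextKernel P π n).map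
            (fun x i => if h : i.1 ≤ n then x.1 ⟨i.1, Finset.mem_Iic.2 h⟩ else x.2) := by
        intro π
        have := Kernel.map_frestrictLe_trajMeasure_compProd_eq_map_trajMeasure
          (X := fun _ => Fin S × Fin A) (μ₀ := stateActionLaw ρ π) (κ := nextKernel P π) (a := n)
        rw [trajectoryLaw]
        rw [this, Measure.map_map (measurable_of_countable _) (by fun_prop)]
        congr 1
        funext ω i
        have hi := Finset.mem_Iic.1 i.2
        by_cases h : i.1 ≤ n
        · simp [h, Preorder.frestrictLe]
        · have : i.1 = n + 1 := by omega
          simp [Preorder.frestrictLe, this]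
      simp_rw [h1]
      refine (Measure.measurable_map _ (measurable_of_countable _)).comp ?_
      refine Measure.measurable_of_measurable_coe _ fun s hs => ?_
      simp_rw [Measure.compProd_apply hs, lintegral_fintype]
      refine Finset.measurable_sum _ fun x _ => Measurable.mul ?_ ?_
      · exact Measure.measurable_measure.1 (measurable_stateActionLaw _) _
          (measurable_prodMk_left hs)
      · exact Measure.measurable_measure.1 ih _ (measurableSet_singleton x)
  -- second, cylinders generate the σ-algebra
  refine Measurable.measure_of_isPiSystem_of_isProbabilityMeasure
    generateFrom_measurableCylinders.symm isPiSystem_measurableCylinders fun t ht => ?_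
  obtain ⟨N, s, hs, rfl⟩ : ∃ N s, MeasurableSet s ∧ t = cylinder (Finset.Iic N) s := by
    simpa [measurableCylinders_nat] using ht
  have h2 : ∀ π : Policy S A, trajectoryLaw P ρ π (cylinder (Finset.Iic N) s) =
      (trajectoryLaw P ρ π).map
        (Preorder.frestrictLe (π := fun _ : ℕ => Fin S × Fin A) N) s := by
    intro π
    rw [Measure.map_apply (by fun_prop) hs]
    rfl
  simp_rw [h2]
  exact Measure.measurable_measure.1 (hfin N) s hs

/-- The law of an episode of `M` as a Markov kernel: policy to trajectory started from `d₀`. -/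
noncomputable def AdversarialMDP.episodeKernel {S A K : ℕ} (M : AdversarialMDP S A K) :
    Kernel (Policy S A) (Trajectory S A) where
  toFun π := trajectoryLaw M.P M.d₀ π
  measurable' := measurable_trajectoryLaw M.P M.d₀

/-! ### Algorithms and regret -/

/-- What happened in the first `k` episodes: the policies chosen and the trajectories observed. -/
abbrev History (S A k : ℕ) : Type := Fin k → Policy S A × Trajectory S A

/-- A (randomized) learning algorithm. It is given the initial distribution and the model class;
before episode `k` it has moreover observed the policies and trajectories of the earlier episodes
and their loss functions, and it draws the policy of episode `k` from a distribution that may depend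
on all of this. -/
structure Algorithm (d S A K : ℕ) where
  act : stdSimplex ℝ (Fin S) → ModelClass d S A → (k : Fin K) →
    (Fin k → Fin S → Fin A → ℝ) → Kernel (History S A k) (Policy S A)
  isMarkovKernel : ∀ d₀ C k l, IsMarkovKernel (act d₀ C k l)

/-- The loss functions of the episodes before episode `k`. -/
def AdversarialMDP.pastLosses {S A K : ℕ} (M : AdversarialMDP S A K) (k : Fin K) :
    Fin k → Fin S → Fin A → ℝ :=
  fun j => M.loss ⟨j, j.2.trans k.2⟩

/-- The law of the first `k` episodes when `alg`, given the model class `C`, interacts with `M`: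
after `k` episodes, the algorithm draws a policy `π` given the past, and then a trajectory is drawn
by executing `π` in `M`; the pair is appended to the history. -/
noncomputable def historyLaw {d S A K : ℕ} (M : AdversarialMDP S A K) (C : ModelClass d S A)
    (alg : Algorithm d S A K) : (k : ℕ) → k ≤ K → Measure (History S A k)
  | 0, _ => Measure.dirac Fin.elim0
  | k + 1, hk =>
    (historyLaw M C alg k (Nat.le_of_succ_le hk) ⊗ₘ
      (alg.act M.d₀ C ⟨k, hk⟩ (M.pastLosses ⟨k, hk⟩) ⊗ₖ M.episodeKernel.prodMkLeft _)).map
        fun x => Fin.snoc x.1 x.2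

/-- The expected regret `𝔼[∑_k (V_k^{π_k} - V_k^{π'})]` of `alg` after `K` episodes, with respect to
the comparator policy `π'`. -/
noncomputable def expectedRegret {d S A K : ℕ} (M : AdversarialMDP S A K) (C : ModelClass d S A)
    (alg : Algorithm d S A K) (π' : Policy S A) : ℝ :=
  ∫ h, ∑ k : Fin K, (M.value k (h k).1 - M.value k π') ∂(historyLaw M C alg K le_rfl)

/-! The hard instance hides a bandit with `m * A` arms, `m = d - 4`. The first action selects one of
`m` bandit states (or a spare one), the second action tosses a coin, and the coin decides between
two absorbing states, of which the bad one costs 1 per step. Hence the value is `γ ^ 2 / (1 - γ)`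
times the probability of the bad state. All coins are fair except that of one arm `θ`, which
succeeds with probability `1 / 2 + ε`. An episode reveals a single toss, whatever the policy: the
rest of the infinite trajectory carries no information. Only `m + 4` states are reachable, so
transition vectors and basis vectors are features of dimension `m + 4`. The model class consists of
all positions of `θ` and so does not reveal it.

Let `W` be the total weight that the chosen policies give to `θ`. The regret is `γ ^ 2 / (1 - γ) * ε
* (K - 𝔼 W)`. If all coins are fair, some `θ` has `𝔼₀ W ≤ K / (m * A)`, by averaging
(`exists_integral_sum_armWeight_le`). The history law with good arm `θ` has a density `D` with
respect to the fair one, a product over episodes in which the kernels of the algorithm cancel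
(`historyLaw_eq_withDensity`). By the chain rule, `𝔼₀[-log D] ≤ 4 * ε ^ 2 * 𝔼₀ W`. The pointwise
inequality `mul_sub_one_le_of_mem_Icc` plays the role of Pinsker's inequality and yields `𝔼 W ≤ K /
4 + (1 + 20 * K * ε ^ 2) * 𝔼₀ W` (`integral_sum_le_of_density`).

With `ε ^ 2 = m * A / (80 * K)` this is at most `11 / 20 * K`, so the regret is at least a constant
times `γ ^ 2 / (1 - γ) * ε * K`, which has the required order because `d ≤ 2 * m`. -/

/-! ### Prefix probabilities and densities of trajectory laws -/

theorem stateActionLaw_singleton {S A : ℕ} (ρ : stdSimplex ℝ (Fin S)) (π : Policy S A)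
    (x : Fin S × Fin A) :
    stateActionLaw ρ π {x} = ENNReal.ofReal (ρ x.1 * π x.1 x.2) := by
  classical
  simp only [stateActionLaw, Measure.coe_finsetSum, Finset.sum_apply, Measure.smul_apply,
    smul_eq_mul]
  rw [Finset.sum_eq_single x]
  · simp
  · intro y _ hy
    simp [hy]
  · simp

theorem stepKernel_singleton {S A : ℕ} (P : Fin S → Fin A → stdSimplex ℝ (Fin S))
    (π : Policy S A) (x y : Fin S × Fin A) :
    stepKernel P π x {y} = ENNReal.ofReal (P x.1 x.2 y.1 * π y.1 y.2) :=
  stateActionLaw_singleton _ _ _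

theorem trajectoryLaw_map_zero {S A : ℕ} (P : Fin S → Fin A → stdSimplex ℝ (Fin S))
    (ρ : stdSimplex ℝ (Fin S)) (π : Policy S A) :
    (trajectoryLaw P ρ π).map (fun ω => ω 0) = stateActionLaw ρ π := by
  have h0 : (trajectoryLaw P ρ π).map
      (Preorder.frestrictLe (π := fun _ : ℕ => Fin S × Fin A) 0) =
      (stateActionLaw ρ π).map (MeasurableEquiv.piUnique
        (fun i : Finset.Iic (0 : ℕ) => (fun _ : ℕ => Fin S × Fin A) i)).symm := by
    rw [trajectoryLaw, Kernel.trajMeasure, Measure.map_comp _ _ (by fun_prop),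
      Kernel.traj_map_frestrictLe, Kernel.partialTraj_self, Measure.id_comp]
  have h1 : (fun ω : Trajectory S A => ω 0) =
      (MeasurableEquiv.piUnique (fun i : Finset.Iic (0 : ℕ) => (fun _ : ℕ => Fin S × Fin A) i)) ∘
        (Preorder.frestrictLe (π := fun _ : ℕ => Fin S × Fin A) 0) := rfl
  rw [h1, ← Measure.map_map (MeasurableEquiv.measurable _) (by fun_prop), h0,
    Measure.map_map (MeasurableEquiv.measurable _) (MeasurableEquiv.measurable _),
    MeasurableEquiv.self_comp_symm, Measure.map_id]

/-- The probability of a trajectory prefix. -/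
noncomputable def prefixWeight {S A : ℕ} (P : Fin S → Fin A → stdSimplex ℝ (Fin S))
    (ρ : stdSimplex ℝ (Fin S)) (π : Policy S A) (x : Trajectory S A) : ℕ → ℝ
  | 0 => ρ (x 0).1 * π (x 0).1 (x 0).2
  | n + 1 => prefixWeight P ρ π x n *
      (P (x n).1 (x n).2 (x (n + 1)).1 * π (x (n + 1)).1 (x (n + 1)).2)

theorem prefixWeight_nonneg {S A : ℕ} (P : Fin S → Fin A → stdSimplex ℝ (Fin S))
    (ρ : stdSimplex ℝ (Fin S)) (π : Policy S A) (x : Trajectory S A) (n : ℕ) :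
    0 ≤ prefixWeight P ρ π x n := by
  induction n with
  | zero => exact mul_nonneg (by simp) (by simp)
  | succ n ih => exact mul_nonneg ih (mul_nonneg (by simp) (by simp))

theorem trajectoryLaw_prefix {S A : ℕ} (P : Fin S → Fin A → stdSimplex ℝ (Fin S))
    (ρ : stdSimplex ℝ (Fin S)) (π : Policy S A) (x : Trajectory S A) (n : ℕ) :
    trajectoryLaw P ρ π {ω | ∀ i ≤ n, ω i = x i} =
      ENNReal.ofReal (prefixWeight P ρ π x n) := by
  induction n with
  | zero =>
    have : {ω : Trajectory S A | ∀ i ≤ 0, ω i = x i} = (fun ω => ω 0) ⁻¹' {x 0} := by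
      ext ω; simp
    rw [this, ← Measure.map_apply (by fun_prop) (measurableSet_singleton _),
      trajectoryLaw_map_zero, stateActionLaw_singleton]
    rfl
  | succ n ih =>
    have key := Kernel.map_frestrictLe_trajMeasure_compProd_eq_map_trajMeasure
      (X := fun _ => Fin S × Fin A) (μ₀ := stateActionLaw ρ π) (κ := nextKernel P π) (a := n)
    let y : (i : Finset.Iic n) → (fun _ : ℕ => Fin S × Fin A) i := fun i => x i
    have hy : (Preorder.frestrictLe (π := fun _ : ℕ => Fin S × Fin A) n) ⁻¹' {y} =
        {ω | ∀ i ≤ n, ω i = x i} := by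
      ext ω
      simp [funext_iff, y, Preorder.frestrictLe]
    have hset : {ω : Trajectory S A | ∀ i ≤ n + 1, ω i = x i} =
        (fun ω => (Preorder.frestrictLe (π := fun _ : ℕ => Fin S × Fin A) n ω, ω (n + 1))) ⁻¹'
          ({y} ×ˢ {x (n + 1)}) := by
      ext ω
      have := Set.ext_iff.1 hy ω
      simp only [Set.mem_preimage, Set.mem_singleton_iff, Set.mem_ofPred_eq] at this
      simp only [Set.mem_preimage, Set.mem_prod, Set.mem_singleton_iff, Set.mem_ofPred_eq, this]
      constructor
      · exact fun h => ⟨fun i hi => h i (by omega), h _ le_rfl⟩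
      · rintro ⟨h, h'⟩ i hi
        rcases Nat.lt_or_ge n i with hn | hn
        · obtain rfl : i = n + 1 := by omega
          exact h'
        · exact h i hn
    rw [hset, ← Measure.map_apply (by fun_prop) (by measurability), trajectoryLaw, ← key,
      Measure.compProd_apply_prod (measurableSet_singleton _) (measurableSet_singleton _),
      lintegral_singleton, Measure.map_apply (by fun_prop) (measurableSet_singleton _), hy]
    rw [trajectoryLaw] at ih
    rw [ih, prefixWeight, ENNReal.ofReal_mul (prefixWeight_nonneg _ _ _ _ _), mul_comm]
    congr 1
    exact stepKernel_singleton P π (x n) (x (n + 1))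

/-- Measures on trajectories that agree on all prefixes of length at least three are equal. -/
theorem trajectoryMeasure_ext {S A : ℕ} (μ ν : Measure (Trajectory S A)) [IsFiniteMeasure μ]
    (h : ∀ (x : Trajectory S A) (n : ℕ), 2 ≤ n →
      μ {ω | ∀ i ≤ n, ω i = x i} = ν {ω | ∀ i ≤ n, ω i = x i}) : μ = ν := by
  have hmap : ∀ n, 2 ≤ n →
      μ.map (Preorder.frestrictLe (π := fun _ : ℕ => Fin S × Fin A) n) =
      ν.map (Preorder.frestrictLe (π := fun _ : ℕ => Fin S × Fin A) n) := by
    intro n hn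
    refine Measure.ext_of_singleton fun y => ?_
    rw [Measure.map_apply (by fun_prop) (measurableSet_singleton _),
      Measure.map_apply (by fun_prop) (measurableSet_singleton _)]
    -- The values of `x` beyond `n` are irrelevant.
    let x : Trajectory S A := fun i => if hi : i ≤ n then y ⟨i, Finset.mem_Iic.2 hi⟩ else
      y ⟨0, by simp⟩
    have hy : (Preorder.frestrictLe (π := fun _ : ℕ => Fin S × Fin A) n) ⁻¹' {y} =
        {ω | ∀ i ≤ n, ω i = x i} := by
      ext ω
      simp only [Set.mem_preimage, Set.mem_singleton_iff, funext_iff, Set.mem_ofPred_eq]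
      constructor
      · intro h i hi
        simpa [x, hi, Preorder.frestrictLe] using h ⟨i, Finset.mem_Iic.2 hi⟩
      · rintro h ⟨i, hi⟩
        have := h i (Finset.mem_Iic.1 hi)
        simpa [x, Finset.mem_Iic.1 hi, Preorder.frestrictLe] using this
    rw [hy]
    exact h x n hn
  have hcyl : ∀ t ∈ measurableCylinders (fun _ : ℕ => Fin S × Fin A), μ t = ν t := by
    intro t ht
    obtain ⟨N, s, hs, rfl⟩ : ∃ N s, MeasurableSet s ∧ t = cylinder (Finset.Iic N) s := by
      simpa [measurableCylinders_nat] using ht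
    -- Lengthening the prefix by two meets the restriction `2 ≤ n` of the hypothesis.
    have h2 : cylinder (Finset.Iic N) s =
        (Preorder.frestrictLe (π := fun _ : ℕ => Fin S × Fin A) (N + 2)) ⁻¹'
          ((fun y (i : Finset.Iic N) => y ⟨i.1, Finset.mem_Iic.2
            ((Finset.mem_Iic.1 i.2).trans (by omega))⟩) ⁻¹' s) := rfl
    have hs' : MeasurableSet ((fun (y : (i : Finset.Iic (N + 2)) → (fun _ : ℕ => Fin S × Fin A) i)
        (i : Finset.Iic N) => y ⟨i.1, Finset.mem_Iic.2
            ((Finset.mem_Iic.1 i.2).trans (by omega))⟩) ⁻¹' s) :=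
      (measurable_of_countable _) hs
    rw [h2, ← Measure.map_apply (by fun_prop) hs', ← Measure.map_apply (by fun_prop) hs',
      hmap _ (by omega)]
  refine ext_of_generate_finite _ generateFrom_measurableCylinders.symm
    isPiSystem_measurableCylinders hcyl (hcyl _ ?_)
  exact univ_mem_measurableCylinders _

theorem measurableSet_prefix {S A : ℕ} (x : Trajectory S A) (n : ℕ) :
    MeasurableSet {ω : Trajectory S A | ∀ i ≤ n, ω i = x i} := by
  have : {ω : Trajectory S A | ∀ i ≤ n, ω i = x i} =
      ⋂ i, ⋂ (_ : i ≤ n), (fun ω => ω i) ⁻¹' {x i} := by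
    ext ω; simp
  rw [this]
  exact .iInter fun i => .iInter fun _ => measurable_pi_apply i (measurableSet_singleton _)

/-- Two trajectory laws whose prefix probabilities have a ratio that depends only on the second and
third state-action pair are related by the corresponding density. -/
theorem trajectoryLaw_eq_withDensity {S A : ℕ} {P Q : Fin S → Fin A → stdSimplex ℝ (Fin S)}
    {ρ : stdSimplex ℝ (Fin S)} {π : Policy S A} {L : Fin S × Fin A → Fin S × Fin A → ℝ}
    (hL : ∀ x y, 0 ≤ L x y)
    (h : ∀ (x : Trajectory S A) (n : ℕ), 2 ≤ n →
      prefixWeight P ρ π x n = L (x 1) (x 2) * prefixWeight Q ρ π x n) :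
    trajectoryLaw P ρ π =
      (trajectoryLaw Q ρ π).withDensity fun ω => ENNReal.ofReal (L (ω 1) (ω 2)) := by
  refine trajectoryMeasure_ext _ _ fun x n hn => ?_
  rw [withDensity_apply _ (measurableSet_prefix x n), trajectoryLaw_prefix, h x n hn,
    setLIntegral_congr_fun (g := fun _ => ENNReal.ofReal (L (x 1) (x 2)))
      (measurableSet_prefix x n), setLIntegral_const, trajectoryLaw_prefix,
      ENNReal.ofReal_mul (hL _ _)]
  intro ω hω
  simp [hω 1 (by omega), hω 2 hn]

/-- Expectation of a function of the first three state-action pairs. -/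
theorem integral_trajectoryLaw {S A : ℕ} (P : Fin S → Fin A → stdSimplex ℝ (Fin S))
    (ρ : stdSimplex ℝ (Fin S)) (π : Policy S A)
    (f : Fin S × Fin A → Fin S × Fin A → Fin S × Fin A → ℝ) :
    ∫ ω, f (ω 0) (ω 1) (ω 2) ∂(trajectoryLaw P ρ π) =
      ∑ x, ∑ y, ∑ z, ρ x.1 * π x.1 x.2 * (P x.1 x.2 y.1 * π y.1 y.2) *
        (P y.1 y.2 z.1 * π z.1 z.2) * f x y z := by
  let T : Trajectory S A → (Fin S × Fin A) × (Fin S × Fin A) × (Fin S × Fin A) :=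
    fun ω => (ω 0, ω 1, ω 2)
  have hT : Measurable T := by fun_prop
  have h1 : ∫ ω, f (ω 0) (ω 1) (ω 2) ∂(trajectoryLaw P ρ π) =
      ∫ t, f t.1 t.2.1 t.2.2 ∂((trajectoryLaw P ρ π).map T) := by
    rw [integral_map hT.aemeasurable (measurable_of_countable _).aestronglyMeasurable]
  have : IsProbabilityMeasure ((trajectoryLaw P ρ π).map T) :=
    Measure.isProbabilityMeasure_map hT.aemeasurable
  rw [h1, integral_fintype Integrable.of_finite, Fintype.sum_prod_type]
  simp_rw [Fintype.sum_prod_type (α₁ := Fin S × Fin A)]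
  refine Finset.sum_congr rfl fun x _ => Finset.sum_congr rfl fun y _ =>
    Finset.sum_congr rfl fun z _ => ?_
  rw [Measure.real, Measure.map_apply hT (measurableSet_singleton _)]
  have hset : T ⁻¹' {(x, y, z)} = {ω | ∀ i ≤ 2, ω i =
      (fun i => if i = 0 then x else if i = 1 then y else z : Trajectory S A) i} := by
    ext ω
    simp only [T, Set.mem_preimage, Set.mem_singleton_iff, Prod.mk.injEq, Set.mem_ofPred_eq]
    constructor
    · rintro ⟨h0, h1, h2⟩ i hi
      interval_cases i <;> simp [*]
    · intro h
      exact ⟨by simpa using h 0, by simpa using h 1, by simpa using h 2⟩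
  rw [hset, trajectoryLaw_prefix, ENNReal.toReal_ofReal (prefixWeight_nonneg _ _ _ _ _)]
  simp [prefixWeight]

/-! ### Laws of histories and their densities -/

instance {S A K : ℕ} (M : AdversarialMDP S A K) : IsMarkovKernel M.episodeKernel :=
  ⟨fun π => inferInstanceAs (IsProbabilityMeasure (trajectoryLaw M.P M.d₀ π))⟩

theorem measurable_history_snoc {S A k : ℕ} :
    Measurable fun x : History S A k × Policy S A × Trajectory S A =>
      (Fin.snoc x.1 x.2 : History S A (k + 1)) := by
  refine measurable_pi_iff.2 fun i => ?_
  refine Fin.lastCases ?_ (fun j => ?_) i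
  · simpa using measurable_snd
  · simp only [Fin.snoc_castSucc]
    exact (measurable_pi_apply j).comp measurable_fst

instance {d S A K : ℕ} (M : AdversarialMDP S A K) (C : ModelClass d S A)
    (alg : Algorithm d S A K) (k : ℕ) (hk : k ≤ K) :
    IsProbabilityMeasure (historyLaw M C alg k hk) := by
  induction k with
  | zero => unfold historyLaw; infer_instance
  | succ k ih =>
    unfold historyLaw
    have := alg.isMarkovKernel M.d₀ C ⟨k, hk⟩ (M.pastLosses ⟨k, hk⟩)
    have := ih (Nat.le_of_succ_le hk)
    exact Measure.isProbabilityMeasure_map measurable_history_snoc.aemeasurable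

/-- In unsigned form, the unfolding of the last episode needs no integrability; the change of
measure below tests equality of measures with it. -/
theorem lintegral_historyLaw_succ {d S A K : ℕ} (M : AdversarialMDP S A K) (C : ModelClass d S A)
    (alg : Algorithm d S A K) (k : ℕ) (hk : k + 1 ≤ K) {f : History S A (k + 1) → ENNReal}
    (hf : Measurable f) :
    ∫⁻ h, f h ∂(historyLaw M C alg (k + 1) hk) =
      ∫⁻ h, ∫⁻ π, ∫⁻ ω, f (Fin.snoc h (π, ω)) ∂(M.episodeKernel π)
        ∂(alg.act M.d₀ C ⟨k, hk⟩ (M.pastLosses ⟨k, hk⟩) h)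
        ∂(historyLaw M C alg k (Nat.le_of_succ_le hk)) := by
  have := alg.isMarkovKernel M.d₀ C ⟨k, hk⟩ (M.pastLosses ⟨k, hk⟩)
  have hf' := hf.comp (measurable_history_snoc (S := S) (A := A) (k := k))
  rw [historyLaw, lintegral_map hf measurable_history_snoc, Measure.lintegral_compProd (f := fun x => f (Fin.snoc x.1 x.2)) hf']
  refine lintegral_congr fun h => ?_
  exact Kernel.lintegral_compProd _ _ h (hf'.comp measurable_prodMk_left)

/-- Change of measure for histories: if the trajectory law of `M'` has density `L` with respect to
that of `M`, for every policy, then the law of the history in `M'` has the product density. -/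
theorem historyLaw_eq_withDensity {d S A K : ℕ} {M M' : AdversarialMDP S A K}
    (hd : M'.d₀ = M.d₀) (hl : M'.loss = M.loss) {L : Trajectory S A → ENNReal}
    (hL : Measurable L)
    (h : ∀ π, M'.episodeKernel π = (M.episodeKernel π).withDensity L)
    (C : ModelClass d S A) (alg : Algorithm d S A K) (k : ℕ) (hk : k ≤ K) :
    historyLaw M' C alg k hk =
      (historyLaw M C alg k hk).withDensity fun x => ∏ j, L (x j).2 := by
  have hD : ∀ k : ℕ, Measurable fun x : History S A k => ∏ j, L (x j).2 := fun k =>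
    Finset.measurable_prod _ fun j _ => hL.comp (measurable_snd.comp (measurable_pi_apply j))
  induction k with
  | zero => simp [historyLaw]
  | succ k ih =>
    -- Equal losses and initial distributions give the algorithm the same kernel in both MDPs, so
    -- that only the trajectory densities remain.
    have hpl : M'.pastLosses ⟨k, hk⟩ = M.pastLosses ⟨k, hk⟩ := by
      funext j
      simp only [AdversarialMDP.pastLosses, hl]
    have := alg.isMarkovKernel M.d₀ C ⟨k, hk⟩ (M.pastLosses ⟨k, hk⟩)
    refine Measure.ext_of_lintegral _ fun f hf => ?_
    have hsn := measurable_history_snoc (S := S) (A := A) (k := k)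
    have hsn' : ∀ (h : History S A k) (π : Policy S A), Measurable fun ω : Trajectory S A =>
        (Fin.snoc h (π, ω) : History S A (k + 1)) := fun h π =>
      hsn.comp (measurable_prodMk_left.comp measurable_prodMk_left)
    rw [lintegral_historyLaw_succ _ _ _ _ _ hf, lintegral_withDensity_eq_lintegral_mul _ (hD _) hf,
      lintegral_historyLaw_succ _ _ _ _ _ ((hD _).mul hf), ih (Nat.le_of_succ_le hk), hd, hpl,
      lintegral_withDensity_eq_lintegral_mul _ (hD _) ?_]
    · refine lintegral_congr fun x => ?_
      rw [Pi.mul_apply, ← lintegral_const_mul]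
      · refine lintegral_congr fun π => ?_
        have hfx : Measurable fun ω : Trajectory S A => f (Fin.snoc x (π, ω)) :=
          hf.comp (hsn' x π)
        rw [h π, lintegral_withDensity_eq_lintegral_mul _ hL hfx,
          ← lintegral_const_mul _ (hL.mul hfx)]
        refine lintegral_congr fun ω => ?_
        simp [Fin.prod_univ_castSucc, mul_assoc]
      · exact Measurable.lintegral_kernel_prod_right (κ := M'.episodeKernel)
          (f := fun π ω => f (Fin.snoc x (π, ω))) (hf.comp (hsn.comp measurable_prodMk_left))
    · have h1 : Measurable fun p : History S A k × Policy S A =>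
          ∫⁻ ω, f (Fin.snoc p.1 (p.2, ω)) ∂(M'.episodeKernel p.2) :=
        Measurable.lintegral_kernel_prod_right (κ := M'.episodeKernel.prodMkLeft (History S A k))
          (f := fun p ω => f (Fin.snoc p.1 (p.2, ω)))
          ((hf.comp hsn).comp (by fun_prop : Measurable
            fun q : (History S A k × Policy S A) × Trajectory S A => (q.1.1, q.1.2, q.2)))
      exact Measurable.lintegral_kernel_prod_right
        (κ := alg.act M.d₀ C ⟨k, hk⟩ (M.pastLosses ⟨k, hk⟩))
        (f := fun x π => ∫⁻ ω, f (Fin.snoc x (π, ω)) ∂(M'.episodeKernel π)) h1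

theorem integrable_of_measurable_of_bounds {α : Type*} [MeasurableSpace α] {μ : Measure α}
    [IsFiniteMeasure μ] {f : α → ℝ} (hf : Measurable f) {a b : ℝ} (h : ∀ x, f x ∈ Set.Icc a b) :
    Integrable f μ :=
  .of_mem_Icc a b hf.aemeasurable (ae_of_all _ h)

theorem measurable_history_sum {S A k : ℕ} {F : Policy S A × Trajectory S A → ℝ}
    (hF : Measurable F) : Measurable fun h : History S A k => ∑ j, F (h j) :=
  Finset.measurable_sum _ fun j _ => hF.comp (measurable_pi_apply j)

theorem history_sum_mem_Icc {S A k : ℕ} {F : Policy S A × Trajectory S A → ℝ} {a b : ℝ}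
    (hb : ∀ x, F x ∈ Set.Icc a b) (h : History S A k) :
    ∑ j, F (h j) ∈ Set.Icc (k * a) (k * b) := by
  constructor
  · simpa using Finset.card_nsmul_le_sum Finset.univ (fun j => F (h j)) a fun j _ => (hb _).1
  · simpa using Finset.sum_le_card_nsmul Finset.univ (fun j => F (h j)) b fun j _ => (hb _).2

/-- A function of the episode whose conditional mean given the policy is nonpositive has a
nonpositive expected sum. -/
theorem integral_history_sum_nonpos {d S A K : ℕ} (M : AdversarialMDP S A K) (C : ModelClass d S A)
    (alg : Algorithm d S A K) {F : Policy S A × Trajectory S A → ℝ} (hF : Measurable F) {a b : ℝ}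
    (hb : ∀ x, F x ∈ Set.Icc a b) (h0 : ∀ π, ∫ ω, F (π, ω) ∂(M.episodeKernel π) ≤ 0)
    (k : ℕ) (hk : k ≤ K) :
    ∫ h, ∑ j, F (h j) ∂(historyLaw M C alg k hk) ≤ 0 := by
  induction k with
  | zero => simp
  | succ k ih =>
    have := alg.isMarkovKernel M.d₀ C ⟨k, hk⟩ (M.pastLosses ⟨k, hk⟩)
    have hsn := measurable_history_snoc (S := S) (A := A) (k := k)
    have hm := measurable_history_sum (k := k + 1) hF
    rw [historyLaw, integral_map hsn.aemeasurable hm.aestronglyMeasurable]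
    simp only [Fin.sum_univ_castSucc, Fin.snoc_castSucc, Fin.snoc_last]
    have hi1 : Integrable (fun x : History S A k × Policy S A × Trajectory S A =>
        ∑ j, F (x.1 j)) (historyLaw M C alg k (Nat.le_of_succ_le hk) ⊗ₘ
      (alg.act M.d₀ C ⟨k, hk⟩ (M.pastLosses ⟨k, hk⟩) ⊗ₖ M.episodeKernel.prodMkLeft _)) :=
      integrable_of_measurable_of_bounds ((measurable_history_sum hF).comp measurable_fst)
        fun x => history_sum_mem_Icc hb x.1
    have hi2 : Integrable (fun x : History S A k × Policy S A × Trajectory S A =>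
        F x.2) (historyLaw M C alg k (Nat.le_of_succ_le hk) ⊗ₘ
      (alg.act M.d₀ C ⟨k, hk⟩ (M.pastLosses ⟨k, hk⟩) ⊗ₖ M.episodeKernel.prodMkLeft _)) :=
      integrable_of_measurable_of_bounds (hF.comp measurable_snd) fun x => hb x.2
    rw [integral_add hi1 hi2, Measure.integral_compProd hi1, Measure.integral_compProd hi2]
    refine add_nonpos ?_ ?_
    · simpa using ih (Nat.le_of_succ_le hk)
    · refine integral_nonpos fun x => ?_
      rw [Pi.zero_apply, ProbabilityTheory.integral_compProd
        (integrable_of_measurable_of_bounds hF fun x => hb x)]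
      exact integral_nonpos fun π => h0 π

/-! ### Comparison of expectations through relative entropy -/

/-- For `D ≤ 1` the left side is nonpositive and the right side positive. For `D ≥ 1` it suffices to
take `x = 1`: the tangent of `log` at `5 / 4` has slope `4 / 5`, and `5 * (1 - 4 / 5) = 1`; the
constant `1 / 4` absorbs the offset since `log (5 / 4) ≤ 1 / 4`. After integration `D - 1` vanishes
and `-log D` becomes the relative entropy. -/
theorem mul_sub_one_le_of_mem_Icc {x D : ℝ} (hx : x ∈ Set.Icc (0 : ℝ) 1) (hD : 0 < D) :
    x * (D - 1) ≤ 1 / 4 + 5 * (D - 1 - Real.log D) := by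
  have h1 := Real.log_le_sub_one_of_pos hD
  have h2 := Real.log_le_sub_one_of_pos (show 0 < D / (5 / 4) by positivity)
  have h3 := Real.log_le_sub_one_of_pos (show (0 : ℝ) < 5 / 4 by norm_num)
  rw [Real.log_div hD.ne' (by norm_num)] at h2
  rcases le_total D 1 with h | h
  · nlinarith [mul_nonneg hx.1 (sub_nonneg.2 h)]
  · nlinarith [mul_nonneg (sub_nonneg.2 hx.2) (sub_nonneg.2 h)]

/-- If the divergence per episode between two MDPs is at most a multiple of a policy weight, then
so is the difference between the expected total weights, up to a constant fraction of `K`. -/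
theorem integral_sum_le_of_density {d S A K : ℕ} {M M' : AdversarialMDP S A K}
    (hd : M'.d₀ = M.d₀) (hl : M'.loss = M.loss) {L : Trajectory S A → ℝ}
    (hL : Measurable L) {a b : ℝ} (ha : 0 < a) (hLab : ∀ ω, L ω ∈ Set.Icc a b)
    (h : ∀ π, M'.episodeKernel π = (M.episodeKernel π).withDensity fun ω => ENNReal.ofReal (L ω))
    {w : Policy S A → ℝ} (hw : Measurable w) (hw01 : ∀ π, w π ∈ Set.Icc (0 : ℝ) 1) {κ : ℝ}
    (hκ0 : 0 ≤ κ) (hκ : ∀ π, ∫ ω, -Real.log (L ω) ∂(M.episodeKernel π) ≤ κ * w π) (hK : 0 < K)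
    (C : ModelClass d S A) (alg : Algorithm d S A K) :
    ∫ h, ∑ j, w (h j).1 ∂(historyLaw M' C alg K le_rfl) ≤
      K / 4 + (1 + 5 * K * κ) * ∫ h, ∑ j, w (h j).1 ∂(historyLaw M C alg K le_rfl) := by
  have hK' : (0 : ℝ) < K := by exact_mod_cast hK
  set H := historyLaw M C alg K le_rfl
  let D : History S A K → ℝ := fun x => ∏ j, L (x j).2
  let W : History S A K → ℝ := fun x => ∑ j, w (x j).1
  have hpos : ∀ ω, 0 < L ω := fun ω => ha.trans_le (hLab ω).1
  have hDm : Measurable D :=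
    Finset.measurable_prod _ fun j _ => hL.comp (measurable_snd.comp (measurable_pi_apply j))
  have hDpos : ∀ x, 0 < D x := fun x => Finset.prod_pos fun j _ => hpos _
  have hDb : ∀ x, D x ∈ Set.Icc 0 (b ^ K) := fun x =>
    ⟨(hDpos x).le, by
      simpa [D] using Finset.prod_le_prod (s := Finset.univ) (f := fun j => L (x j).2)
        (g := fun _ : Fin K => b) (fun j _ => (hpos _).le) (fun j _ => (hLab _).2)⟩
  have hWm : Measurable W := measurable_history_sum (hw.comp measurable_fst)
  have hWb : ∀ x, W x ∈ Set.Icc 0 (K : ℝ) := fun x => by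
    simpa using history_sum_mem_Icc (F := fun y => w y.1) (fun y => hw01 y.1) x
  have hDens : historyLaw M' C alg K le_rfl = H.withDensity fun x => ENNReal.ofReal (D x) := by
    rw [historyLaw_eq_withDensity hd hl (ENNReal.measurable_ofReal.comp hL) h C alg K le_rfl]
    congr 1
    funext x
    exact (ENNReal.ofReal_prod_of_nonneg fun j _ => (hpos _).le).symm
  have hchange : ∀ f : History S A K → ℝ,
      ∫ x, f x ∂(historyLaw M' C alg K le_rfl) = ∫ x, D x * f x ∂H := fun f => by
    rw [hDens, integral_withDensity_eq_integral_toReal_smul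
      (f := fun x => ENNReal.ofReal (D x))
      (ENNReal.measurable_ofReal.comp hDm) (ae_of_all _ fun x => ENNReal.ofReal_lt_top)]
    simp only [ENNReal.toReal_ofReal (hDpos _).le, smul_eq_mul]
  have hD1 : ∫ x, D x ∂H = 1 := by simpa using (hchange fun _ => 1).symm
  have hlogm : Measurable fun x : Policy S A × Trajectory S A => Real.log (L x.2) :=
    Real.measurable_log.comp (hL.comp measurable_snd)
  have hlogb : ∀ ω, Real.log (L ω) ∈ Set.Icc (Real.log a) (Real.log b) := fun ω =>
    ⟨Real.log_le_log ha (hLab ω).1, Real.log_le_log (hpos ω) (hLab ω).2⟩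
  have hlogD : ∀ x, Real.log (D x) = ∑ j, Real.log (L (x j).2) := fun x =>
    Real.log_prod fun j _ => (hpos _).ne'
  have iD : Integrable D H := integrable_of_measurable_of_bounds hDm hDb
  have iW : Integrable W H := integrable_of_measurable_of_bounds hWm hWb
  have iDW : Integrable (fun x => D x * W x) H :=
    integrable_of_measurable_of_bounds (hDm.mul hWm) (a := 0) (b := b ^ K * K) fun x =>
      ⟨mul_nonneg (hDb x).1 (hWb x).1,
        mul_le_mul (hDb x).2 (hWb x).2 (hWb x).1 ((hDb x).1.trans (hDb x).2)⟩
  have ilog : Integrable (fun x => Real.log (D x)) H := by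
    simp_rw [hlogD]
    exact integrable_of_measurable_of_bounds (measurable_history_sum hlogm)
      fun x => history_sum_mem_Icc (F := fun y => Real.log (L y.2)) (fun y => hlogb y.2) x
  -- Chain rule for relative entropy: the divergence of the histories is the sum of the conditional
  -- divergences of the episodes, each at most `κ * w`.
  have hlogint : ∫ x, -Real.log (D x) - κ * W x ∂H ≤ 0 := by
    have := integral_history_sum_nonpos M C alg
      (F := fun x => -Real.log (L x.2) - κ * w x.1)
      (hlogm.neg.sub ((hw.comp measurable_fst).const_mul κ))
      (a := -Real.log b - κ) (b := -Real.log a)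
      (fun x => by
        have h1 := hlogb x.2
        have h2 := hw01 x.1
        constructor
        · nlinarith [h1.2, h2.2]
        · nlinarith [h1.1, mul_nonneg hκ0 h2.1])
      (fun π => by
        have i1 : Integrable (fun ω => -Real.log (L ω)) (M.episodeKernel π) :=
          (integrable_of_measurable_of_bounds (Real.measurable_log.comp hL) hlogb).neg
        dsimp only
        rw [integral_sub i1 (integrable_const _)]
        simpa using hκ π) K le_rfl
    refine le_trans (le_of_eq ?_) this
    refine integral_congr_ae (ae_of_all _ fun x => ?_)
    simp [hlogD, W, Finset.mul_sum, Finset.sum_sub_distrib]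
  rw [integral_sub (f := fun x => -Real.log (D x)) ilog.neg (iW.const_mul κ), integral_neg, integral_const_mul] at hlogint
  -- The pointwise inequality is applied to `W x / K`, which lies in `[0, 1]`, and then multiplied
  -- by `K`.
  have hpt : ∀ x, D x * W x - W x ≤ K * (1 / 4 + 5 * (D x - 1 - Real.log (D x))) := fun x => by
    have hx : W x / K ∈ Set.Icc (0 : ℝ) 1 :=
      ⟨div_nonneg (hWb x).1 hK'.le, (div_le_one hK').2 (hWb x).2⟩
    have := mul_le_mul_of_nonneg_left (mul_sub_one_le_of_mem_Icc hx (hDpos x)) hK'.le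
    refine le_trans (le_of_eq ?_) this
    field_simp
  have iR : Integrable (fun x => D x - 1 - Real.log (D x)) H :=
    (iD.sub (integrable_const _)).sub ilog
  have hmono := integral_mono (iDW.sub iW)
    (((integrable_const (1 / 4 : ℝ)).add (iR.const_mul 5)).const_mul (K : ℝ)) hpt
  have e1 : ∫ x, (D x * W x - W x) ∂H = ∫ x, D x * W x ∂H - ∫ x, W x ∂H := integral_sub iDW iW
  have e2 : ∫ x, (K : ℝ) * (1 / 4 + 5 * (D x - 1 - Real.log (D x))) ∂H =
      K * (1 / 4 - 5 * ∫ x, Real.log (D x) ∂H) := by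
    rw [integral_const_mul, integral_add (integrable_const _) (iR.const_mul 5), integral_const_mul,
      integral_sub (f := fun x => D x - 1) (iD.sub (integrable_const _)) ilog, integral_sub iD (integrable_const _), hD1]
    simp only [integral_const, probReal_univ, one_smul]
    ring
  have hmono' : ∫ x, D x * W x ∂H - ∫ x, W x ∂H ≤ K * (1 / 4 - 5 * ∫ x, Real.log (D x) ∂H) := by
    rw [← e1, ← e2]; exact hmono
  have h5 := mul_le_mul_of_nonneg_left hlogint (mul_nonneg (by norm_num : (0:ℝ) ≤ 5) hK'.le)
  have : ∫ x, W x ∂(historyLaw M' C alg K le_rfl) = ∫ x, D x * W x ∂H := hchange W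
  change ∫ x, W x ∂(historyLaw M' C alg K le_rfl) ≤ K / 4 + (1 + 5 * K * κ) * ∫ x, W x ∂H
  rw [this]
  nlinarith

/-! ### Almost sure prefixes and two-point distributions -/

theorem prefixWeight_succ {S A : ℕ} (P : Fin S → Fin A → stdSimplex ℝ (Fin S))
    (ρ : stdSimplex ℝ (Fin S)) (π : Policy S A) (x : Trajectory S A) (n : ℕ) :
    prefixWeight P ρ π x (n + 1) = prefixWeight P ρ π x n *
      (P (x n).1 (x n).2 (x (n + 1)).1 * π (x (n + 1)).1 (x (n + 1)).2) := rfl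

theorem prefixWeight_congr {S A : ℕ} (P : Fin S → Fin A → stdSimplex ℝ (Fin S))
    (ρ : stdSimplex ℝ (Fin S)) (π : Policy S A) {x y : Trajectory S A} {n : ℕ}
    (h : ∀ i ≤ n, x i = y i) : prefixWeight P ρ π x n = prefixWeight P ρ π y n := by
  induction n with
  | zero => simp [prefixWeight, h 0 le_rfl]
  | succ n ih =>
    rw [prefixWeight, prefixWeight, ih fun i hi => h i (by omega), h n (by omega), h (n + 1) le_rfl]

/-- For each `n` there are finitely many prefixes, and those of weight zero form a null set. Facts
about prefixes of nonzero weight thereby hold almost surely. -/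
theorem ae_prefixWeight_ne_zero {S A : ℕ} (P : Fin S → Fin A → stdSimplex ℝ (Fin S))
    (ρ : stdSimplex ℝ (Fin S)) (π : Policy S A) :
    ∀ᵐ ω ∂(trajectoryLaw P ρ π), ∀ n, prefixWeight P ρ π ω n ≠ 0 := by
  refine ae_all_iff.2 fun n => ?_
  let e : (Fin (n + 1) → Fin S × Fin A) → Trajectory S A := fun y i =>
    if h : i < n + 1 then y ⟨i, h⟩ else y 0
  have hcov : {ω | ¬ prefixWeight P ρ π ω n ≠ 0} ⊆
      ⋃ y, ⋃ (_ : prefixWeight P ρ π (e y) n = 0), {ω | ∀ i ≤ n, ω i = e y i} := by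
    intro ω hω
    have hω' : prefixWeight P ρ π ω n = 0 := by simpa using hω
    have he : ∀ i ≤ n, ω i = e (fun i => ω i) i := fun i hi => by
      simp only [e, dif_pos (Nat.lt_succ_of_le hi)]
    exact Set.mem_iUnion.2 ⟨fun i => ω i, Set.mem_iUnion.2
      ⟨(prefixWeight_congr P ρ π he).symm.trans hω', he⟩⟩
  refine measure_mono_null hcov (measure_iUnion_null fun y => measure_iUnion_null fun hy => ?_)
  rw [trajectoryLaw_prefix, hy, ENNReal.ofReal_zero]

theorem sum_stateAction {S A : ℕ} (ρ : stdSimplex ℝ (Fin S)) (π : Policy S A)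
    (c : Fin S × Fin A → ℝ) :
    ∑ x, ρ x.1 * π x.1 x.2 * c x = ∑ s, ρ s * ∑ a, π s a * c (s, a) := by
  simp [Fintype.sum_prod_type, Finset.mul_sum, mul_assoc]

theorem stdSimplex_vertex_apply {n : ℕ} (s t : Fin n) :
    (stdSimplex.vertex s : stdSimplex ℝ (Fin n)) t = if t = s then 1 else 0 := by
  simp [stdSimplex.vertex, Pi.single_apply]

/-- The distribution that puts mass `t` on `g` and mass `1 - t` on `b`. -/
noncomputable def twoPoint {n : ℕ} (g b : Fin n) (t : unitInterval) : stdSimplex ℝ (Fin n) :=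
  ⟨fun s => t * (if s = g then 1 else 0) + (1 - t) * (if s = b then 1 else 0), by
    constructor
    · intro s
      have h1 := t.2.1
      have h2 := t.2.2
      have : (0 : ℝ) ≤ 1 - t := by linarith
      positivity
    · simp [Finset.sum_add_distrib]⟩

theorem twoPoint_apply {n : ℕ} (g b : Fin n) (t : unitInterval) (s : Fin n) :
    twoPoint g b t s = t * (if s = g then 1 else 0) + (1 - t) * (if s = b then 1 else 0) := rfl

theorem sum_vertex_mul {n : ℕ} (s : Fin n) (c : Fin n → ℝ) :
    ∑ t, (stdSimplex.vertex s : stdSimplex ℝ (Fin n)) t * c t = c s := by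
  simp [stdSimplex_vertex_apply]

theorem sum_twoPoint_mul {n : ℕ} (g b : Fin n) (t : unitInterval) (c : Fin n → ℝ) :
    ∑ s, twoPoint g b t s * c s = t * c g + (1 - t) * c b := by
  simp [twoPoint_apply, add_mul, Finset.sum_add_distrib]

/-! ### The tree-shaped transition kernel -/

section Tree

variable {m S A : ℕ} (hS : m + 4 ≤ S)

/-- The state with number `j`: `0` is the initial state, `1, …, m` are the bandit states, `m + 1` is
a bandit state without a good action, `m + 2` is the good and `m + 3` the bad absorbing state. -/
def treeState (j : ℕ) (hj : j < m + 4) : Fin S := ⟨j, hj.trans_le hS⟩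

/-- The state that action `a` leads to in the initial state. -/
def childState (a : Fin A) : Fin S := treeState hS (1 + min a.1 m) (by omega)

/-- The actions of the initial state select a bandit state; in a bandit state, action `a` leads to
the good state with probability `p s a` and otherwise to the bad state; these two are absorbing. -/
noncomputable def treeKernel (p : Fin S → Fin A → unitInterval) (s : Fin S) (a : Fin A) :
    stdSimplex ℝ (Fin S) :=
  if s.1 = 0 then stdSimplex.vertex (childState hS a)
  else if s.1 = m + 2 ∨ s.1 = m + 3 then stdSimplex.vertex s
  else twoPoint (treeState hS (m + 2) (by omega)) (treeState hS (m + 3) (by omega)) (p s a)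

/-- The likelihood ratio between success probabilities `p` and fair coins. -/
noncomputable def treeRatio (m : ℕ) (p : Fin S → Fin A → unitInterval) (y : Fin S × Fin A)
    (z : Fin S) : ℝ :=
  if z.1 = m + 2 then 2 * p y.1 y.2 else if z.1 = m + 3 then 2 * (1 - p y.1 y.2) else 1

theorem treeRatio_nonneg (m : ℕ) (p : Fin S → Fin A → unitInterval) (y : Fin S × Fin A)
    (z : Fin S) : 0 ≤ treeRatio m p y z := by
  have h1 := (p y.1 y.2).2.1
  have h2 := (p y.1 y.2).2.2
  unfold treeRatio
  split_ifs <;> linarith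

/-- Fair coins. -/
noncomputable def fairCoin : Fin S → Fin A → unitInterval := fun _ _ =>
  ⟨1 / 2, by norm_num, by norm_num⟩

variable (p : Fin S → Fin A → unitInterval) (π : Policy S A)

theorem treeKernel_zero {s : Fin S} (hs : s.1 = 0) (a : Fin A) :
    treeKernel hS p s a = stdSimplex.vertex (childState hS a) := if_pos hs

theorem treeKernel_absorbing {s : Fin S} (hs : s.1 = m + 2 ∨ s.1 = m + 3) (a : Fin A) :
    treeKernel hS p s a = stdSimplex.vertex s := by
  rw [treeKernel, if_neg (by omega), if_pos hs]

theorem treeKernel_bandit {s : Fin S} (hs : 1 ≤ s.1 ∧ s.1 ≤ m + 1) (a : Fin A) :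
    treeKernel hS p s a = twoPoint (treeState hS (m + 2) (by omega))
      (treeState hS (m + 3) (by omega)) (p s a) := by
  rw [treeKernel, if_neg (by omega), if_neg (by omega)]

/-- The initial distribution. -/
noncomputable def treeInit : stdSimplex ℝ (Fin S) :=
  stdSimplex.vertex (treeState hS 0 (by omega))

variable {hS p π}

theorem prefix_state_zero {x : Trajectory S A}
    (h : prefixWeight (treeKernel hS p) (treeInit hS) π x 0 ≠ 0) : (x 0).1.1 = 0 := by
  have h1 := left_ne_zero_of_mul h
  rw [treeInit, stdSimplex_vertex_apply] at h1
  by_contra h2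
  exact h1 (if_neg fun h3 => h2 (by rw [h3]; rfl))

theorem prefix_state_one {x : Trajectory S A}
    (h : prefixWeight (treeKernel hS p) (treeInit hS) π x 1 ≠ 0) :
    1 ≤ (x 1).1.1 ∧ (x 1).1.1 ≤ m + 1 := by
  have h0 := prefix_state_zero (left_ne_zero_of_mul h)
  have h1 := left_ne_zero_of_mul (right_ne_zero_of_mul h)
  rw [treeKernel_zero hS p h0, stdSimplex_vertex_apply] at h1
  have h2 : (x 1).1 = childState hS (x 0).2 := by
    by_contra h2
    exact h1 (if_neg h2)
  rw [h2]
  simp only [childState, treeState]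
  omega

theorem prefix_state_two {x : Trajectory S A}
    (h : prefixWeight (treeKernel hS p) (treeInit hS) π x 2 ≠ 0) :
    (x 2).1.1 = m + 2 ∨ (x 2).1.1 = m + 3 := by
  have h0 := prefix_state_one (left_ne_zero_of_mul h)
  have h1 := left_ne_zero_of_mul (right_ne_zero_of_mul h)
  rw [treeKernel_bandit hS p h0, twoPoint_apply] at h1
  by_contra! h2
  refine h1 ?_
  rw [if_neg fun h3 => h2.1 (by rw [h3]; rfl), if_neg fun h3 => h2.2 (by rw [h3]; rfl)]
  simp

/-- From time 2 on the state is frozen; this serves both the density, to which later steps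
contribute nothing, and the discounted loss. -/
theorem prefix_state_absorbed {x : Trajectory S A} (n : ℕ)
    (h : prefixWeight (treeKernel hS p) (treeInit hS) π x (n + 2) ≠ 0) :
    (x (n + 2)).1 = (x 2).1 ∧ ((x 2).1.1 = m + 2 ∨ (x 2).1.1 = m + 3) := by
  induction n with
  | zero => exact ⟨rfl, prefix_state_two h⟩
  | succ n ih =>
    obtain ⟨ih1, ih2⟩ := ih (left_ne_zero_of_mul h)
    have h1 := left_ne_zero_of_mul (right_ne_zero_of_mul h)
    rw [treeKernel_absorbing hS p (by rw [ih1]; exact ih2), stdSimplex_vertex_apply] at h1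
    refine ⟨?_, ih2⟩
    rw [← ih1]
    by_contra h2
    exact h1 (if_neg h2)

theorem prefixWeight_one_eq (q : Fin S → Fin A → unitInterval) (x : Trajectory S A) :
    prefixWeight (treeKernel hS p) (treeInit hS) π x 1 =
      prefixWeight (treeKernel hS q) (treeInit hS) π x 1 := by
  rw [prefixWeight_succ (treeKernel hS p) _ _ _ 0, prefixWeight_succ (treeKernel hS q) _ _ _ 0]
  by_cases h : prefixWeight (treeKernel hS p) (treeInit hS) π x 0 = 0
  · have h' : prefixWeight (treeKernel hS q) (treeInit hS) π x 0 = 0 := h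
    rw [h, h', zero_mul, zero_mul]
  · have h0 := prefix_state_zero h
    rw [treeKernel_zero hS p h0, treeKernel_zero hS q h0]
    rfl

theorem twoPoint_eq_treeRatio_mul (y : Fin S × Fin A) (z : Fin S) :
    twoPoint (treeState hS (m + 2) (by omega)) (treeState hS (m + 3) (by omega)) (p y.1 y.2) z =
      treeRatio m p y z * twoPoint (treeState hS (m + 2) (by omega))
        (treeState hS (m + 3) (by omega)) (fairCoin y.1 y.2) z := by
  simp only [twoPoint_apply, treeRatio, fairCoin, treeState, Fin.ext_iff]
  split_ifs <;> first | omega | ring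

/-- The success probabilities enter only in the passage from the second pair to the third state.
Before it the bandit state is chosen deterministically, after it the state is absorbing. -/
theorem prefixWeight_eq_treeRatio_mul (x : Trajectory S A) (n : ℕ) :
    prefixWeight (treeKernel hS p) (treeInit hS) π x (n + 2) = treeRatio m p (x 1) (x 2).1 *
      prefixWeight (treeKernel hS fairCoin) (treeInit hS) π x (n + 2) := by
  induction n with
  | zero =>
    rw [prefixWeight_succ (treeKernel hS p) _ _ _ 1,
      prefixWeight_succ (treeKernel hS fairCoin) _ _ _ 1, prefixWeight_one_eq fairCoin]
    by_cases h : prefixWeight (treeKernel hS fairCoin) (treeInit hS) π x 1 = 0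
    · rw [h]; simp
    · have h1 := prefix_state_one h
      rw [treeKernel_bandit hS p h1, treeKernel_bandit hS fairCoin h1, twoPoint_eq_treeRatio_mul]
      ring
  | succ n ih =>
    rw [show n + 1 + 2 = n + 2 + 1 from rfl, prefixWeight_succ (treeKernel hS p) _ _ _ (n + 2),
      prefixWeight_succ (treeKernel hS fairCoin) _ _ _ (n + 2), ih]
    by_cases h : prefixWeight (treeKernel hS fairCoin) (treeInit hS) π x (n + 2) = 0
    · rw [h]; simp
    · obtain ⟨h1, h2⟩ := prefix_state_absorbed n h
      rw [← h1] at h2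
      rw [treeKernel_absorbing hS p h2, treeKernel_absorbing hS fairCoin h2]
      ring

theorem trajectoryLaw_tree_eq_withDensity :
    trajectoryLaw (treeKernel hS p) (treeInit hS) π =
      (trajectoryLaw (treeKernel hS fairCoin) (treeInit hS) π).withDensity
        fun ω => ENNReal.ofReal (treeRatio m p (ω 1) (ω 2).1) := by
  refine trajectoryLaw_eq_withDensity (L := fun y z => treeRatio m p y z.1)
    (fun y z => treeRatio_nonneg m p y z.1) fun x n hn => ?_
  obtain ⟨n, rfl⟩ := Nat.exists_eq_add_of_le' hn
  exact prefixWeight_eq_treeRatio_mul x n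

theorem integral_trajectoryLaw_tree (f : Fin S × Fin A → Fin S → ℝ) :
    ∫ ω, f (ω 1) (ω 2).1 ∂(trajectoryLaw (treeKernel hS p) (treeInit hS) π) =
      ∑ a, π (treeState hS 0 (by omega)) a * ∑ a', π (childState hS a) a' *
        (p (childState hS a) a' * f (childState hS a, a') (treeState hS (m + 2) (by omega)) +
          (1 - p (childState hS a) a') *
            f (childState hS a, a') (treeState hS (m + 3) (by omega))) := by
  rw [integral_trajectoryLaw _ _ _ fun _ y z => f y z.1]
  simp_rw [mul_assoc _ _ (f _ _), mul_assoc _ (_ * _) (_ * _), ← Finset.mul_sum]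
  rw [sum_stateAction, treeInit, sum_vertex_mul]
  refine Finset.sum_congr rfl fun a _ => ?_
  congr 1
  rw [treeKernel_zero hS p rfl]
  simp_rw [← mul_assoc]
  -- The third action sums out because `f` sees only the third state.
  have hz : ∀ y : Fin S × Fin A, ∑ z : Fin S × Fin A,
      treeKernel hS p y.1 y.2 z.1 * π z.1 z.2 * f y z.1 =
        ∑ s, treeKernel hS p y.1 y.2 s * f y s := fun y => by
    rw [sum_stateAction _ _ fun z => f y z.1]
    refine Finset.sum_congr rfl fun s _ => ?_
    dsimp only
    rw [← Finset.sum_mul]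
    simp
  simp_rw [hz]
  rw [sum_stateAction, sum_vertex_mul]
  refine Finset.sum_congr rfl fun a' _ => ?_
  congr 1
  dsimp only
  rw [treeKernel_bandit hS p, sum_twoPoint_mul]
  simp only [childState, treeState]
  omega

end Tree

/-! ### The tree MDP and its value -/

section TreeMDP

variable {m S A K : ℕ} {hS : m + 4 ≤ S} {p : Fin S → Fin A → unitInterval} {γ : ℝ}

/-- The loss is one in the bad state and zero elsewhere. -/
noncomputable def treeLoss (m : ℕ) (s : Fin S) : ℝ := if s.1 = m + 3 then 1 else 0

/-- The tree MDP with success probabilities `p`. -/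
noncomputable def treeMDP (K : ℕ) (hS : m + 4 ≤ S) (p : Fin S → Fin A → unitInterval)
    (h0 : 0 ≤ γ) (h1 : γ < 1) : AdversarialMDP S A K where
  P := treeKernel hS p
  loss _ s _ := treeLoss m s
  loss_mem _ s _ := by unfold treeLoss; split_ifs <;> simp
  γ := γ
  γ_nonneg := h0
  γ_lt_one := h1
  d₀ := treeInit hS

/-- The first two states are free of loss and the loss is constant from time 2 on, which leaves a
geometric series starting at `γ ^ 2`. -/
theorem ae_tsum_treeLoss (h0 : 0 ≤ γ) (h1 : γ < 1) (π : Policy S A) :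
    ∀ᵐ ω ∂(trajectoryLaw (treeKernel hS p) (treeInit hS) π),
      ∑' τ : ℕ, γ ^ τ * treeLoss m (ω τ).1 = γ ^ 2 / (1 - γ) * treeLoss m (ω 2).1 := by
  filter_upwards [ae_prefixWeight_ne_zero (treeKernel hS p) (treeInit hS) π] with ω hω
  have e0 : treeLoss m (ω 0).1 = 0 := by
    have := prefix_state_zero (hω 0)
    exact if_neg (by omega)
  have e1 : treeLoss m (ω 1).1 = 0 := by
    have := prefix_state_one (hω 1)
    exact if_neg (by omega)
  have hs : HasSum (fun n : ℕ => γ ^ (n + 2) * treeLoss m (ω (n + 2)).1)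
      (γ ^ 2 / (1 - γ) * treeLoss m (ω 2).1) := by
    have := (hasSum_geometric_of_lt_one h0 h1).mul_left (γ ^ 2 * treeLoss m (ω 2).1)
    rw [show γ ^ 2 / (1 - γ) * treeLoss m (ω 2).1 = γ ^ 2 * treeLoss m (ω 2).1 * (1 - γ)⁻¹ by
      rw [div_eq_mul_inv]; ring]
    have e : (fun n : ℕ => γ ^ (n + 2) * treeLoss m (ω (n + 2)).1) =
        fun n => γ ^ 2 * treeLoss m (ω 2).1 * γ ^ n := by
      funext n
      rw [(prefix_state_absorbed n (hω (n + 2))).1]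
      ring
    rw [e]
    exact this
  have := (hasSum_nat_add_iff (f := fun τ : ℕ => γ ^ τ * treeLoss m (ω τ).1) 2).1 hs
  rw [this.tsum_eq]
  simp [Finset.sum_range_succ, e0, e1]

theorem treeMDP_value (h0 : 0 ≤ γ) (h1 : γ < 1) (k : Fin K) (π : Policy S A) :
    (treeMDP K hS p h0 h1).value k π = γ ^ 2 / (1 - γ) *
      ∑ a, π (treeState hS 0 (by omega)) a * ∑ a', π (childState hS a) a' *
        (1 - p (childState hS a) a') := by
  have hv : (treeMDP K hS p h0 h1).value k π =
      (treeMDP K hS p h0 h1).stateValue k π (treeState hS 0 (by omega)) :=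
    sum_vertex_mul _ _
  rw [hv]
  change ∫ ω, ∑' τ : ℕ, γ ^ τ * treeLoss m (ω τ).1
    ∂(trajectoryLaw (treeKernel hS p) (treeInit hS) π) = _
  rw [integral_congr_ae (ae_tsum_treeLoss h0 h1 π), integral_const_mul,
    integral_trajectoryLaw_tree fun _ s => treeLoss m s]
  simp [treeLoss, treeState]

/-! ### Arms and the hidden good arm -/

/-- The probability of playing action `i` in the initial state and then action `j`. -/
noncomputable def armWeight (hS : m + 4 ≤ S) (hA : m ≤ A) (θ : Fin m × Fin A) (π : Policy S A) :
    ℝ :=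
  π (treeState hS 0 (by omega)) (θ.1.castLE hA) *
    π (treeState hS (1 + θ.1) (by omega)) θ.2

variable {hA : m ≤ A}

theorem childState_castLE (i : Fin m) :
    childState hS (i.castLE hA) = treeState hS (1 + i.1) (by omega) := by
  simp only [childState, treeState, Fin.val_castLE, Fin.ext_iff]
  omega

theorem stdSimplex_apply_le_one {n : ℕ} (x : stdSimplex ℝ (Fin n)) (i : Fin n) : x i ≤ 1 := by
  rw [← stdSimplex.sum_eq_one x]
  exact Finset.single_le_sum (f := fun i => x i) (fun j _ => by simp) (Finset.mem_univ i)

theorem armWeight_mem_Icc (θ : Fin m × Fin A) (π : Policy S A) :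
    armWeight hS hA θ π ∈ Set.Icc (0 : ℝ) 1 :=
  ⟨mul_nonneg (by simp) (by simp),
    mul_le_one₀ (stdSimplex_apply_le_one _ _) (by simp) (stdSimplex_apply_le_one _ _)⟩

theorem measurable_armWeight (θ : Fin m × Fin A) :
    Measurable (armWeight hS hA θ : Policy S A → ℝ) :=
  (measurable_policy_apply _ _).mul (measurable_policy_apply _ _)

/-- The sum can fall short of one because initial actions beyond the first `m` lead to the spare
bandit state. -/
theorem sum_armWeight_le_one (π : Policy S A) : ∑ θ, armWeight hS hA θ π ≤ 1 := by
  have h1 : ∑ θ, armWeight hS hA θ π =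
      ∑ i : Fin m, π (treeState hS 0 (by omega)) (i.castLE hA) := by
    rw [Fintype.sum_prod_type]
    refine Finset.sum_congr rfl fun i _ => ?_
    simp only [armWeight]
    rw [← Finset.mul_sum]
    exact (congrArg _ (stdSimplex.sum_eq_one
      (π (treeState hS (1 + i.1) (by omega))))).trans (mul_one _)
  rw [h1, ← stdSimplex.sum_eq_one (π (treeState hS 0 (by omega)))]
  refine (Finset.sum_map Finset.univ (Fin.castLEEmb hA)
    fun a => π (treeState hS 0 (by omega)) a).symm.le.trans ?_
  exact Finset.sum_le_sum_of_subset_of_nonneg (Finset.subset_univ _) fun _ _ _ => by simp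

/-- The indicator of the arm factors into indicators of the two actions. This gives both the value
and the divergence of an episode as affine functions of the arm weight. -/
theorem sum_ite_armWeight (θ : Fin m × Fin A) (π : Policy S A) (u v : ℝ) :
    ∑ a, π (treeState hS 0 (by omega)) a * ∑ a', π (childState hS a) a' *
      (if (childState hS a).1 = 1 + θ.1.1 ∧ a' = θ.2 then u else v) =
    v + (u - v) * armWeight hS hA θ π := by
  have h1 : ∀ a a', (if (childState hS a).1 = 1 + θ.1.1 ∧ a' = θ.2 then u else v) =
      v + (u - v) * ((if a = θ.1.castLE hA then 1 else 0) * (if a' = θ.2 then 1 else 0)) := by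
    intro a a'
    have h2 : (childState hS a).1 = 1 + θ.1.1 ↔ a = θ.1.castLE hA := by
      have := θ.1.2
      simp only [childState, treeState, Fin.ext_iff, Fin.val_castLE]
      omega
    simp only [h2]
    split_ifs <;> simp_all
  simp_rw [h1, mul_add, Finset.sum_add_distrib, ← Finset.sum_mul, stdSimplex.sum_eq_one,
    one_mul, mul_add, Finset.sum_add_distrib, ← Finset.sum_mul, stdSimplex.sum_eq_one, one_mul]
  congr 1
  rw [Finset.sum_eq_single (θ.1.castLE hA)]
  · simp [armWeight, childState_castLE]
    ring
  · intro a _ ha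
    simp [ha]
  · simp

/-- Success probabilities one half, except for the arm `θ`, which has `1 / 2 + ε`. -/
noncomputable def needle (θ : Fin m × Fin A) {ε : ℝ} (h0 : 0 ≤ ε) (h1 : ε ≤ 1 / 4) :
    Fin S → Fin A → unitInterval := fun s a =>
  if s.1 = 1 + θ.1.1 ∧ a = θ.2 then ⟨1 / 2 + ε, by linarith, by linarith⟩
  else ⟨1 / 2, by norm_num, by norm_num⟩

theorem needle_apply (θ : Fin m × Fin A) {ε : ℝ} (h0 : 0 ≤ ε) (h1 : ε ≤ 1 / 4) (s : Fin S)
    (a : Fin A) : (needle θ h0 h1 s a : ℝ) =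
      if s.1 = 1 + θ.1.1 ∧ a = θ.2 then 1 / 2 + ε else 1 / 2 := by
  unfold needle
  split_ifs <;> rfl

theorem needle_value (θ : Fin m × Fin A) {ε : ℝ} (hε0 : 0 ≤ ε) (hε1 : ε ≤ 1 / 4)
    (h0 : 0 ≤ γ) (h1 : γ < 1) (k : Fin K) (π : Policy S A) :
    (treeMDP K hS (needle θ hε0 hε1) h0 h1).value k π =
      γ ^ 2 / (1 - γ) * (1 / 2 - ε * armWeight hS hA θ π) := by
  rw [treeMDP_value]
  simp_rw [needle_apply]
  have := sum_ite_armWeight (hS := hS) (hA := hA) θ π (1 / 2 - ε) (1 / 2)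
  congr 1
  rw [show 1 / 2 - ε * armWeight hS hA θ π =
    1 / 2 + (1 / 2 - ε - 1 / 2) * armWeight hS hA θ π by ring, ← this]
  refine Finset.sum_congr rfl fun a _ => ?_
  congr 1
  refine Finset.sum_congr rfl fun a' _ => ?_
  congr 1
  split_ifs <;> ring

theorem needle_treeRatio_mem_Icc (θ : Fin m × Fin A) {ε : ℝ} (hε0 : 0 ≤ ε) (hε1 : ε ≤ 1 / 4)
    (y : Fin S × Fin A) (z : Fin S) :
    treeRatio m (needle θ hε0 hε1) y z ∈ Set.Icc (1 / 2 : ℝ) (3 / 2) := by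
  unfold treeRatio
  rw [needle_apply]
  constructor <;> split_ifs <;> linarith

/-- The left side is the divergence of a fair coin from a coin of bias `ε`, namely `-log (1 - u) /
2` with `u = 4 * ε ^ 2`. Here `-log (1 - u) ≤ (1 - u)⁻¹ - 1 ≤ 2 * u`, since `u ≤ 1 / 4`. -/
theorem neg_log_mul_le {ε : ℝ} (hε0 : 0 ≤ ε) (hε1 : ε ≤ 1 / 4) :
    (-Real.log (1 + 2 * ε) + -Real.log (1 - 2 * ε)) / 2 ≤ 4 * ε ^ 2 := by
  have hpos : 0 < 1 - 4 * ε ^ 2 := by nlinarith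
  have h1 := Real.one_sub_inv_le_log_of_pos hpos
  have h2 : Real.log (1 - 4 * ε ^ 2) = Real.log (1 + 2 * ε) + Real.log (1 - 2 * ε) := by
    rw [← Real.log_mul (by linarith) (by linarith)]
    congr 1
    ring
  have h3 : (1 - 4 * ε ^ 2)⁻¹ ≤ 1 + 8 * ε ^ 2 := by
    rw [inv_le_iff_one_le_mul₀' hpos]
    nlinarith [sq_nonneg ε, mul_nonneg (sq_nonneg ε) (show 0 ≤ 1 / 8 - ε ^ 2 by nlinarith)]
  linarith

/-- Away from the arm `θ` the likelihood ratio is one and its logarithm vanishes, so an episode is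
informative only to the extent that its policy plays `θ`. -/
theorem integral_neg_log_treeRatio_le (θ : Fin m × Fin A) {ε : ℝ} (hε0 : 0 ≤ ε)
    (hε1 : ε ≤ 1 / 4) (π : Policy S A) :
    ∫ ω, -Real.log (treeRatio m (needle θ hε0 hε1) (ω 1) (ω 2).1)
      ∂(trajectoryLaw (treeKernel hS fairCoin) (treeInit hS) π) ≤
      4 * ε ^ 2 * armWeight hS hA θ π := by
  rw [integral_trajectoryLaw_tree fun y z => -Real.log (treeRatio m (needle θ hε0 hε1) y z)]
  have h1 : ∀ s : Fin S, ∀ a : Fin A,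
      ((fairCoin s a : unitInterval) : ℝ) * -Real.log (treeRatio m (needle θ hε0 hε1) (s, a)
          (treeState hS (m + 2) (by omega))) +
        (1 - ((fairCoin s a : unitInterval) : ℝ)) * -Real.log (treeRatio m (needle θ hε0 hε1) (s, a)
          (treeState hS (m + 3) (by omega))) =
      if s.1 = 1 + θ.1.1 ∧ a = θ.2 then
        (-Real.log (1 + 2 * ε) + -Real.log (1 - 2 * ε)) / 2 else 0 := by
    intro s a
    simp only [treeRatio, needle_apply, treeState, fairCoin, if_true,
      if_neg (show ¬ m + 3 = m + 2 by omega)]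
    split_ifs
    · rw [show (2 : ℝ) * (1 / 2 + ε) = 1 + 2 * ε by ring,
        show (2 : ℝ) * (1 - (1 / 2 + ε)) = 1 - 2 * ε by ring]
      ring
    · norm_num
  simp_rw [h1]
  rw [sum_ite_armWeight (hA := hA) θ π, sub_zero, zero_add]
  exact mul_le_mul_of_nonneg_right (neg_log_mul_le hε0 hε1) (armWeight_mem_Icc θ π).1

/-! ### The low-rank structure -/

theorem treeKernel_apply_eq_zero {s s' : Fin S} {a : Fin A} (h : m + 4 ≤ s'.1) :
    treeKernel hS p s a s' = 0 := by
  unfold treeKernel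
  split_ifs with h1 h2
  · rw [stdSimplex_vertex_apply, if_neg]
    rintro rfl
    simp only [childState, treeState] at h
    omega
  · rw [stdSimplex_vertex_apply, if_neg]
    rintro rfl
    omega
  · rw [twoPoint_apply, if_neg, if_neg]
    · simp
    all_goals
      rintro rfl
      simp only [treeState] at h
      omega

/-- The transition probabilities as features of the state-action pairs. -/
noncomputable def treeφ (hS : m + 4 ≤ S) (p : Fin S → Fin A → unitInterval) :
    StateActionFeature (m + 4) S A :=
  fun s a => WithLp.toLp 2 fun j => treeKernel hS p s a (j.castLE hS)

/-- Standard basis vectors as features of the states. -/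
noncomputable def treeμ (m S : ℕ) : StateFeature (m + 4) S :=
  fun s => if h : s.1 < m + 4 then EuclideanSpace.single ⟨s.1, h⟩ 1 else 0

/-- The zero feature of the surplus states is consistent because no transition enters them. -/
theorem inner_treeμ_treeφ (s s' : Fin S) (a : Fin A) :
    inner ℝ (treeμ m S s') (treeφ hS p s a) = treeKernel hS p s a s' := by
  unfold treeμ
  split_ifs with h
  · simp [treeφ, EuclideanSpace.inner_single_left]
  · simp [treeKernel_apply_eq_zero (not_lt.1 h)]

/-- Entries in `[0, 1]` have squares bounded by themselves, and the entries sum to at most one. -/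
theorem treeφ_normalized : (treeφ hS p).Normalized := by
  intro s a
  rw [EuclideanSpace.norm_eq]
  refine Real.sqrt_le_iff.2 ⟨zero_le_one, ?_⟩
  rw [one_pow]
  have h1 : ∑ j : Fin (m + 4), treeKernel hS p s a (j.castLE hS) ≤ 1 := by
    rw [← stdSimplex.sum_eq_one (treeKernel hS p s a)]
    refine (Finset.sum_map Finset.univ (Fin.castLEEmb hS)
      fun s' => treeKernel hS p s a s').symm.le.trans ?_
    exact Finset.sum_le_sum_of_subset_of_nonneg (Finset.subset_univ _) fun _ _ _ => by simp
  refine le_trans (Finset.sum_le_sum fun j _ => ?_) h1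
  have h2 := stdSimplex_apply_le_one (treeKernel hS p s a) (j.castLE hS)
  have h3 : 0 ≤ treeKernel hS p s a (j.castLE hS) := by simp
  simp only [treeφ, Real.norm_eq_abs, sq_abs]
  nlinarith

/-- By orthonormality the squared norm is a sum of `m + 4` squares of values of `g`. -/
theorem treeμ_normalized (hS : m + 4 ≤ S) : (treeμ m S).Normalized := by
  intro g hg
  rw [EuclideanSpace.norm_eq]
  refine Real.sqrt_le_sqrt ?_
  have h1 : ∀ j : Fin (m + 4), (∑ s, g s • treeμ m S s) j = g (j.castLE hS) := by
    intro j
    rw [WithLp.ofLp_sum, Finset.sum_apply, Finset.sum_eq_single (j.castLE hS)]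
    · simp [treeμ]
    · intro s _ hs
      unfold treeμ
      split_ifs with h
      · have : j ≠ ⟨s.1, h⟩ := fun h' => hs (by rw [h']; rfl)
        simp [this]
      · simp
    · simp
  have h2 : ∀ j : Fin (m + 4), ‖(∑ s, g s • treeμ m S s) j‖ ^ 2 ≤ 1 := by
    intro j
    rw [h1, Real.norm_eq_abs, sq_abs]
    have := hg (j.castLE hS)
    nlinarith [this.1, this.2]
  simpa using Finset.sum_le_sum fun j (_ : j ∈ Finset.univ) => h2 j

theorem treeMDP_factorsThrough (h0 : 0 ≤ γ) (h1 : γ < 1) :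
    (treeMDP K hS p h0 h1).FactorsThrough (treeφ hS p) (treeμ m S) :=
  fun _ _ _ => (inner_treeμ_treeφ _ _ _).symm

/-- The model class of all positions of the good arm. -/
noncomputable def needleClass (hS : m + 4 ≤ S) (A : ℕ) {ε : ℝ} (hε0 : 0 ≤ ε) (hε1 : ε ≤ 1 / 4) :
    ModelClass (m + 4) S A :=
  open Classical in
  { Ψ := {treeμ m S}
    Φ := Finset.univ.image fun θ : Fin m × Fin A => treeφ hS (needle θ hε0 hε1)
    φ_normalized := fun φ hφ => by
      obtain ⟨θ, -, rfl⟩ := Finset.mem_image.1 hφ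
      exact treeφ_normalized
    μ_normalized := fun μ hμ => by
      rw [Finset.mem_singleton.1 hμ]
      exact treeμ_normalized hS
    sum_eq_one := fun μ hμ φ hφ s a => by
      obtain ⟨θ, -, rfl⟩ := Finset.mem_image.1 hφ
      rw [Finset.mem_singleton.1 hμ]
      simp_rw [inner_treeμ_treeφ]
      simp }

theorem needleClass_realizes (θ : Fin m × Fin A) {ε : ℝ} (hε0 : 0 ≤ ε) (hε1 : ε ≤ 1 / 4)
    (h0 : 0 ≤ γ) (h1 : γ < 1) :
    (needleClass hS A hε0 hε1).Realizes (treeMDP K hS (needle θ hε0 hε1) h0 h1) :=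
  ⟨treeμ m S, by simp [needleClass], treeφ hS (needle θ hε0 hε1), by simp [needleClass],
    treeMDP_factorsThrough h0 h1⟩

/-! ### The regret -/

/-- Always plays the good arm. -/
noncomputable def needlePolicy (hA : m ≤ A) (θ : Fin m × Fin A) : Policy S A := fun s =>
  if s.1 = 0 then stdSimplex.vertex (θ.1.castLE hA) else stdSimplex.vertex θ.2

theorem armWeight_needlePolicy (θ : Fin m × Fin A) :
    armWeight hS hA θ (needlePolicy hA θ) = 1 := by
  simp [armWeight, needlePolicy, treeState]

theorem needlePolicy_isOptimal (θ : Fin m × Fin A) {ε : ℝ} (hε0 : 0 ≤ ε) (hε1 : ε ≤ 1 / 4)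
    (h0 : 0 ≤ γ) (h1 : γ < 1) :
    (treeMDP K hS (needle θ hε0 hε1) h0 h1).IsOptimalInHindsight (needlePolicy hA θ) := by
  intro π'
  refine Finset.sum_le_sum fun k _ => ?_
  rw [needle_value (hA := hA), needle_value (hA := hA), armWeight_needlePolicy]
  have hG : 0 ≤ γ ^ 2 / (1 - γ) := div_nonneg (sq_nonneg _) (by linarith)
  refine mul_le_mul_of_nonneg_left ?_ hG
  nlinarith [(armWeight_mem_Icc (hS := hS) (hA := hA) θ π').2]

theorem integrable_sum_armWeight {d : ℕ} (M : AdversarialMDP S A K) (C : ModelClass d S A)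
    (alg : Algorithm d S A K) (θ : Fin m × Fin A) :
    Integrable (fun h : History S A K => ∑ k, armWeight hS hA θ (h k).1)
      (historyLaw M C alg K le_rfl) :=
  integrable_of_measurable_of_bounds
    (measurable_history_sum (F := fun x => armWeight hS hA θ x.1)
      ((measurable_armWeight θ).comp measurable_fst))
    fun h => history_sum_mem_Icc (F := fun x => armWeight hS hA θ x.1)
      (fun x => armWeight_mem_Icc θ x.1) h

theorem expectedRegret_needle {d : ℕ} (θ : Fin m × Fin A) {ε : ℝ} (hε0 : 0 ≤ ε) (hε1 : ε ≤ 1 / 4)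
    (h0 : 0 ≤ γ) (h1 : γ < 1) (C : ModelClass d S A) (alg : Algorithm d S A K) :
    expectedRegret (treeMDP K hS (needle θ hε0 hε1) h0 h1) C alg (needlePolicy hA θ) =
      γ ^ 2 / (1 - γ) * ε * (K - ∫ h, ∑ k, armWeight hS hA θ (h k).1
        ∂(historyLaw (treeMDP K hS (needle θ hε0 hε1) h0 h1) C alg K le_rfl)) := by
  have h2 : ∀ h : History S A K, ∑ k : Fin K,
      ((treeMDP K hS (needle θ hε0 hε1) h0 h1).value k (h k).1 -
        (treeMDP K hS (needle θ hε0 hε1) h0 h1).value k (needlePolicy hA θ)) =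
      γ ^ 2 / (1 - γ) * ε * (K - ∑ k, armWeight hS hA θ (h k).1) := by
    intro h
    have h3 : ∀ k : Fin K, (treeMDP K hS (needle θ hε0 hε1) h0 h1).value k (h k).1 -
        (treeMDP K hS (needle θ hε0 hε1) h0 h1).value k (needlePolicy hA θ) =
        γ ^ 2 / (1 - γ) * ε * (1 - armWeight hS hA θ (h k).1) := fun k => by
      rw [needle_value (hA := hA), needle_value (hA := hA), armWeight_needlePolicy]
      ring
    simp_rw [h3, ← Finset.mul_sum, Finset.sum_sub_distrib]
    simp
  unfold expectedRegret
  simp_rw [h2]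
  rw [integral_const_mul, integral_sub (integrable_const _) (integrable_sum_armWeight _ _ _ _)]
  simp

/-- The fair-coin MDP serves only as a reference law for the histories; it need not be realized by
`C`. -/
theorem integral_sum_armWeight_needle_le {d : ℕ} (hA : m ≤ A) (θ : Fin m × Fin A) {ε : ℝ}
    (hε0 : 0 ≤ ε) (hε1 : ε ≤ 1 / 4)
    (h0 : 0 ≤ γ) (h1 : γ < 1) (hK : 0 < K) (C : ModelClass d S A) (alg : Algorithm d S A K) :
    ∫ h, ∑ k, armWeight hS hA θ (h k).1
        ∂(historyLaw (treeMDP K hS (needle θ hε0 hε1) h0 h1) C alg K le_rfl) ≤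
      K / 4 + (1 + 5 * K * (4 * ε ^ 2)) * ∫ h, ∑ k, armWeight hS hA θ (h k).1
        ∂(historyLaw (treeMDP K hS fairCoin h0 h1) C alg K le_rfl) := by
  have hm : Measurable fun q : (Fin S × Fin A) × (Fin S × Fin A) =>
    treeRatio m (needle θ hε0 hε1) q.1 q.2.1 := measurable_of_countable _
  have hd : ∀ π, (treeMDP K hS (needle θ hε0 hε1) h0 h1).episodeKernel π =
      ((treeMDP K hS fairCoin h0 h1).episodeKernel π).withDensity fun ω =>
        ENNReal.ofReal (treeRatio m (needle θ hε0 hε1) (ω 1) (ω 2).1) := fun π =>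
    trajectoryLaw_tree_eq_withDensity
  have hκ : ∀ π, ∫ ω, -Real.log (treeRatio m (needle θ hε0 hε1) (ω 1) (ω 2).1)
      ∂((treeMDP K hS fairCoin h0 h1).episodeKernel π) ≤ 4 * ε ^ 2 * armWeight hS hA θ π :=
    fun π => integral_neg_log_treeRatio_le θ hε0 hε1 π
  exact integral_sum_le_of_density (M := treeMDP K hS fairCoin h0 h1)
    (M' := treeMDP K hS (needle θ hε0 hε1) h0 h1)
    (L := fun ω => treeRatio m (needle θ hε0 hε1) (ω 1) (ω 2).1) rfl rfl
    (hm.comp (by fun_prop : Measurable fun ω : Trajectory S A => (ω 1, ω 2)))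
    (a := 1 / 2) (b := 3 / 2) (by norm_num) (fun ω => needle_treeRatio_mem_Icc θ hε0 hε1 _ _)
    hd (measurable_armWeight θ) (armWeight_mem_Icc θ) (by positivity) hκ hK C alg

/-- Some arm is played rarely when all coins are fair. -/
theorem exists_integral_sum_armWeight_le {d : ℕ} (hm : 0 < m) (hA : m ≤ A)
    (M : AdversarialMDP S A K) (C : ModelClass d S A) (alg : Algorithm d S A K) :
    ∃ θ : Fin m × Fin A, ∫ h, ∑ k, armWeight hS hA θ (h k).1 ∂(historyLaw M C alg K le_rfl) ≤
      K / (m * A) := by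
  have : Nonempty (Fin m × Fin A) := ⟨⟨⟨0, hm⟩, ⟨0, hm.trans_le hA⟩⟩⟩
  by_contra! hcon
  have h1 : ∑ θ : Fin m × Fin A, ((K : ℝ) / (m * A)) <
      ∑ θ, ∫ h, ∑ k, armWeight hS hA θ (h k).1 ∂(historyLaw M C alg K le_rfl) :=
    Finset.sum_lt_sum_of_nonempty Finset.univ_nonempty fun θ _ => hcon θ
  rw [← integral_finsetSum _ fun θ _ => integrable_sum_armWeight M C alg θ] at h1
  -- Each episode distributes a total weight of at most one over the `m * A` arms, so not all of
  -- them can exceed the average share.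
  have h2 : ∫ h, ∑ θ, ∑ k, armWeight hS hA θ (h k).1 ∂(historyLaw M C alg K le_rfl) ≤ K := by
    have := integral_mono (μ := historyLaw M C alg K le_rfl)
      (f := fun h => ∑ θ, ∑ k, armWeight hS hA θ (h k).1) (g := fun _ => (K : ℝ))
      (integrable_finsetSum _ fun θ _ => integrable_sum_armWeight M C alg θ) (integrable_const _)
      fun h => by
        dsimp only
        rw [Finset.sum_comm]
        simpa using Finset.sum_le_sum fun k (_ : k ∈ Finset.univ) =>
          sum_armWeight_le_one (hS := hS) (hA := hA) (h k).1
    simpa using this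
  have hm' : (0 : ℝ) < m := by exact_mod_cast hm
  have hA' : (0 : ℝ) < A := by exact_mod_cast hm.trans_le hA
  have h3 : ∑ θ : Fin m × Fin A, ((K : ℝ) / (m * A)) = K := by
    simp only [Finset.sum_const, Finset.card_univ, Fintype.card_prod, Fintype.card_fin,
      nsmul_eq_mul, Nat.cast_mul]
    field_simp
  linarith

theorem exists_regret_ge (hm : 4 ≤ m) (hS : m + 4 ≤ S) (hA : m + 1 ≤ A) (hK : 2 * m * A ≤ K)
    (h0 : 0 ≤ γ) (h1 : γ < 1) (alg : Algorithm (m + 4) S A K) :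
    ∃ (θ : Fin m × Fin A) (ε : ℝ) (hε0 : 0 ≤ ε) (hε1 : ε ≤ 1 / 4),
      1 / 30 * (γ ^ 2 / (1 - γ) * √(((m + 4 : ℕ) : ℝ) * A * K)) ≤
        expectedRegret (treeMDP K hS (needle θ hε0 hε1) h0 h1) (needleClass hS A hε0 hε1) alg
          (needlePolicy (Nat.le_of_succ_le hA) θ) := by
  have hm' : (4 : ℝ) ≤ m := by exact_mod_cast hm
  have hA' : (5 : ℝ) ≤ A := by exact_mod_cast (by omega : 5 ≤ A)
  have hK' : 2 * ((m : ℝ) * A) ≤ K := by rw [← mul_assoc]; exact_mod_cast hK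
  have hN : (20 : ℝ) ≤ m * A := by nlinarith
  have hKpos : (0 : ℝ) < K := by linarith
  -- The choice makes `20 * K * ε ^ 2 * (K / (m * A))` equal to `K / 4`.
  set ε : ℝ := √(m * A / (80 * K)) with hε
  have hε0 : 0 ≤ ε := Real.sqrt_nonneg _
  have hεsq : ε ^ 2 = m * A / (80 * K) := Real.sq_sqrt (by positivity)
  have hε1 : ε ≤ 1 / 4 := by
    refine Real.sqrt_le_iff.2 ⟨by norm_num, ?_⟩
    rw [div_le_iff₀ (by positivity)]
    linarith
  obtain ⟨θ, hθ⟩ := exists_integral_sum_armWeight_le (hS := hS) (by omega) (Nat.le_of_succ_le hA)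
    (treeMDP K hS fairCoin h0 h1) (needleClass hS A hε0 hε1) alg
  refine ⟨θ, ε, hε0, hε1, ?_⟩
  have h2 := integral_sum_armWeight_needle_le (hS := hS) (Nat.le_of_succ_le hA) θ hε0 hε1 h0 h1
    (by exact_mod_cast hKpos) (needleClass hS A hε0 hε1) alg
  rw [expectedRegret_needle (hA := Nat.le_of_succ_le hA)]
  set E := ∫ h, ∑ k, armWeight hS (Nat.le_of_succ_le hA) θ (h k).1
        ∂(historyLaw (treeMDP K hS (needle θ hε0 hε1) h0 h1) (needleClass hS A hε0 hε1) alg K le_rfl)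
  have h3 := mul_le_mul_of_nonneg_left hθ (show 0 ≤ 1 + 5 * (K : ℝ) * (4 * ε ^ 2) by positivity)
  have h4 : (1 + 5 * (K : ℝ) * (4 * ε ^ 2)) * (K / (m * A)) = K / (m * A) + K / 4 := by
    rw [hεsq]
    field_simp
    ring
  have h5 : (K : ℝ) / (m * A) ≤ K / 20 := div_le_div_of_nonneg_left hKpos.le (by norm_num) hN
  -- The three contributions are `1 / 4` from the comparison inequality, `1 / 4` from the choice of
  -- `ε`, and `1 / 20` from `20 ≤ m * A`.
  have hE : E ≤ 11 / 20 * K := by linarith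
  have hG : 0 ≤ γ ^ 2 / (1 - γ) := div_nonneg (sq_nonneg _) (by linarith)
  -- This uses `m + 4 ≤ 2 * m` and `2 ≤ 13 ^ 2 / 80`.
  have hsq : √(((m + 4 : ℕ) : ℝ) * A * K) ≤ 13 * (ε * K) := by
    refine Real.sqrt_le_iff.2 ⟨by positivity, ?_⟩
    have h6 : (13 * (ε * K)) ^ 2 = 169 / 80 * (m * A * K) := by
      rw [mul_pow, mul_pow, hεsq]
      field_simp
      ring
    rw [h6]
    push_cast
    have : (0 : ℝ) ≤ A * K := by positivity
    nlinarith [mul_nonneg (sub_nonneg.2 hm') this]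
  calc 1 / 30 * (γ ^ 2 / (1 - γ) * √(((m + 4 : ℕ) : ℝ) * A * K))
      ≤ 1 / 30 * (γ ^ 2 / (1 - γ) * (13 * (ε * K))) := by gcongr
    -- The constant `1 / 30` fits because `13 / 30 ≤ 9 / 20`.
    _ ≤ γ ^ 2 / (1 - γ) * ε * (9 / 20 * K) := by
        have : 0 ≤ γ ^ 2 / (1 - γ) * ε * K := by positivity
        linarith
    _ ≤ γ ^ 2 / (1 - γ) * ε * (K - E) := by
        refine mul_le_mul_of_nonneg_left (by linarith) (mul_nonneg hG hε0)

end TreeMDP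

theorem theorem2 :
    ∃ c : ℝ, 0 < c ∧
      ∀ (d S A K : ℕ) (γ : ℝ), 8 ≤ d → d + 1 ≤ S → d - 3 ≤ A → 2 * (d - 4) * A ≤ K →
        0 ≤ γ → γ < 1 →
        ∀ alg : Algorithm d S A K,
          ∃ (M : AdversarialMDP S A K) (C : ModelClass d S A),
            M.γ = γ ∧ M.IsLowRank d ∧ M.HasFixedLoss ∧ C.Realizes M ∧
            ∃ πstar : Policy S A, M.IsOptimalInHindsight πstar ∧
              c * (γ ^ 2 / (1 - γ) * √((d : ℝ) * A * K)) ≤ expectedRegret M C alg πstar := by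
  refine ⟨1 / 30, by norm_num, fun d S A K γ hd hS hA hK h0 h1 alg => ?_⟩
  obtain ⟨m, rfl⟩ : ∃ m, d = m + 4 := ⟨d - 4, by omega⟩
  rw [Nat.add_sub_cancel] at hK
  have hS' : m + 4 ≤ S := by omega
  obtain ⟨θ, ε, hε0, hε1, h⟩ :=
    exists_regret_ge (by omega) hS' (by omega) hK h0 h1 alg
  exact ⟨treeMDP K hS' (needle θ hε0 hε1) h0 h1, needleClass hS' A hε0 hε1, rfl,
    ⟨_, _, treeMDP_factorsThrough h0 h1, treeφ_normalized, treeμ_normalized hS'⟩, ⟨_, fun _ => rfl⟩,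
    needleClass_realizes θ hε0 hε1 h0 h1, needlePolicy (by omega) θ,
    needlePolicy_isOptimal θ hε0 hε1 h0 h1, h⟩
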